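/- **Allowed region for $(2)(32)^n$.** Three point particles $1,2,3$ move in a plane (identified with $\mathbb C$); their masses satisfy $m_1/m_2=a>0$, $m_3/m_2=b>0$. The particles move freely except at elastic binary collisions; $(k)$ denotes a collision of the two particles other than $k$, its scattering phasor is the unit complex number $x$ by which it multiplies the relative velocity of the colliding particles ($x=1$ is admitted). For $n\ge 1$, the process $(2)(32)^n$ is the sequence of $2n+1$ collisions $(2),(3),(2),\dots,(3),(2)$. It is *classically allowed* for $(a,b)$ if there is a motion with exactly these successive collisions (at each of which the two colliding particles are at the same point), with positive times between consecutive collisions, such that at first $2$ and $3$ are at rest at different points and $1$ moves, and finally $1$ and $2$ have the same velocity (capture). For $n\ge1$ let $C_{2n}$ be the curve $$a=-\cot\tfrac{\theta}{2}\cot n\theta,\quad b=\cot\big((n+\tfrac12)\theta\big)\cot n\theta,\qquad \tfrac{(2n-1)\pi}{2n}<\theta<\tfrac{2n\pi}{2n+1},$$ and for $n\ge 0$ let $C_{2n+1}$ be the curve $$a=\cot\tfrac{\theta}{2}\cot (n+1)\theta,\quad b=\cot\big((n+\tfrac12)\theta\big)\cot (n+1)\theta,\qquad \tfrac{2n\pi}{2n+1}<\theta<\tfrac{(2n+1)\pi}{2n+2}.$$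 Let $n\ge 1$, $a,b>0$, and $I_n=\big(\tfrac{(2n-1)\pi}{2n+1},\pi\big)$. 1. $(2)(32)^n$ is classically allowed for $(a,b)$ if and only if $(a,b)$ lies between $C_{2n}$ and $C_{2n+1}$ or on one of them, that is, there are $b_1\le b\le b_2$ with $(a,b_1)\in C_{2n}$ and $(a,b_2)\in C_{2n+1}$. 2. Consider on $I_n$ the equation $$\frac{\cos^2((n+\frac12)\theta)}{\cos^2(\theta/2)}=\frac{b(1+a)}{a(1+b)}.\qquad(*)$$ It has at most one solution $\theta\in I_n$, and the process is classically allowed if and only if there is a solution with $\sin^2(\theta/2)\le \frac{b}{(a+b)(a+1)}$. In every such capture process, all scattering phasors except the first have the same value $y$, and the angle $\theta\in I_n$ with $\cos\theta=1+\frac{b(y-1)^2}{2y(a+1)(a+b)}$ exists and satisfies $(*)$. 3. The boundary curves are given implicitly by algebraic equations: let $\theta\in(0,\pi)$ be defined by $\theta/2=\arg\big(\sqrt{a(1+a+b)}+i\sqrt b\big)$. Then $(a,b)\in C_{2n}$ if and only if $\theta\in I_n$ and $$\left(\frac{\sqrt{a(a+1+b)}+i\sqrt{b}}{\sqrt{a(a+1+b)}-i\sqrt{b}}\right)^{2n+1}=\frac{\sqrt{b(a+1+b)}-i\sqrt{a}}{\sqrt{b(a+1+b)}+i\sqrt{a}},$$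 and $(a,b)\in C_{2n+1}$ if and only if $\theta\in I_n$ and $$\left(\frac{\sqrt{a(a+1+b)}+i\sqrt{b}}{\sqrt{a(a+1+b)}-i\sqrt{b}}\right)^{2n+1}=\frac{\sqrt{b(a+1+b)}+i\sqrt{a}}{\sqrt{b(a+1+b)}-i\sqrt{a}}.$$ 4. The first four curves are linear, quadratic, cubic and quartic: for $a,b>0$, - $(a,b)\in C_1$ iff $b-a=0$; - $(a,b)\in C_2$ iff $3ab-b+a^2+a=0$; - $(a,b)\in C_3$ iff $3ab^2-b^2+2ba^2+6ab-a^3-a^2=0$ and $b>a$; - $(a,b)\in C_4$ iff $5a^2b^2-10ab^2+b^2+6ba^3-6ab+a^4+2a^3+a^2=0$, $b>a$ and $a<1$. -/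

import Mathlib

open Matrix

noncomputable section

/-- The scattering matrices of the three binary collisions of particles `1, 2, 3` with masses in the
ratio `a : 1 : b`, acting on the vector of the three (planar, complex) velocities. Particles `1, 2, 3`
have the indices `0, 1, 2`; `k` is the index of the spectator, and `x` is the phasor `exp (i α)` of the
scattering angle `α`: the relative velocity of the two colliding particles is multiplied by `x`. -/
def scatteringMatrix (a b : ℝ) (k : Fin 3) (x : ℂ) : Matrix (Fin 3) (Fin 3) ℂ :=
  match k with
  | 0 => (1 / (1 + b) : ℂ) •
      !![1 + (b : ℂ), 0, 0;
         0, 1 + b * x, b * (1 - x);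
         0, 1 - x, b + x]
  | 1 => (1 / (a + b) : ℂ) •
      !![a + b * x, 0, b * (1 - x);
         0, (a : ℂ) + b, 0;
         a * (1 - x), 0, b + a * x]
  | 2 => (1 / (1 + a) : ℂ) •
      !![a + x, 1 - x, 0;
         a * (1 - x), 1 + a * x, 0;
         0, 0, 1 + (a : ℂ)]

/-- The motion described by `x, t, r, v` is a capture process with the `m` successive collisions
`w 0, …, w (m - 1)` (each given by its spectator). Here `x k` is the scattering phasor of collision `k`,
`t k` the time between collisions `k` and `k + 1`, `r k` the positions of the three particles at
collision `k`, `v k` their velocities just before collision `k` (just after it: `v (k + 1)`). -/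
structure IsCaptureProcess (a b : ℝ) (m : ℕ) (w : ℕ → Fin 3)
    (x : ℕ → ℂ) (t : ℕ → ℝ) (r v : ℕ → Fin 3 → ℂ) : Prop where
  /-- at first particle `1` moves, and particles `2` and `3` are at rest at different points -/
  initial_velocity_one : v 0 0 ≠ 0
  initial_velocity_two : v 0 1 = 0
  initial_velocity_three : v 0 2 = 0
  initial_position : r 0 1 ≠ r 0 2
  /-- the scattering angles are real -/
  phasor : ∀ k < m, ‖x k‖ = 1
  /-- the two particles that take part in a collision are then at the same point -/
  meet : ∀ k < m, ∀ i j : Fin 3, i ≠ w k → j ≠ w k → r k i = r k j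
  /-- the collisions are elastic -/
  scatter : ∀ k < m, v (k + 1) = scatteringMatrix a b (w k) (x k) *ᵥ v k
  /-- between collisions the particles move freely, for a positive time -/
  time_pos : ∀ k, k + 1 < m → 0 < t k
  free : ∀ k, k + 1 < m → ∀ i, r (k + 1) i = r k i + t k * v (k + 1) i
  /-- finally particles `1` and `2` have the same velocity -/
  capture : v m 0 = v m 1

/-- The collision sequence `w 0, …, w (m - 1)` can lead to capture for the mass ratios `a, b`. -/
def ClassicallyAllowed (a b : ℝ) (m : ℕ) (w : ℕ → Fin 3) : Prop :=
  ∃ (x : ℕ → ℂ) (t : ℕ → ℝ) (r v : ℕ → Fin 3 → ℂ), IsCaptureProcess a b m w x t r v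

/-- The collisions `(2), (3), (2), (3), …`; the first `2 n + 1` of them are `(2)(32)ⁿ`. -/
def collisions232 (k : ℕ) : Fin 3 := if Even k then 1 else 2

/-- The open interval `((2n-1)π/(2n+1), π)` of the angles `θ`. -/
def thetaInterval (n : ℕ) : Set ℝ :=
  Set.Ioo ((2 * n - 1) * Real.pi / (2 * n + 1)) Real.pi

/-- `cos²((n+1/2)θ) / cos²(θ/2) = b(1+a) / (a(1+b))`. -/
def ThetaEquation (n : ℕ) (a b θ : ℝ) : Prop :=
  Real.cos ((n + 1 / 2) * θ) ^ 2 / Real.cos (θ / 2) ^ 2 = b * (1 + a) / (a * (1 + b))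

/-- The curve `C_{2n}` (for `n ≥ 1`). At the ends of the range of `θ` it runs into the origin and
off to infinity. -/
def curveEven (n : ℕ) : Set (ℝ × ℝ) :=
  (fun θ : ℝ => (-(Real.cot (θ / 2) * Real.cot (n * θ)),
      Real.cot ((n + 1 / 2) * θ) * Real.cot (n * θ))) ''
    Set.Ioo ((2 * n - 1) * Real.pi / (2 * n)) (2 * n * Real.pi / (2 * n + 1))

/-- The curve `C_{2n+1}` (for `n ≥ 0`). At the ends of the range of `θ` it runs off to infinity and
into the origin. -/
def curveOdd (n : ℕ) : Set (ℝ × ℝ) :=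
  (fun θ : ℝ => (Real.cot (θ / 2) * Real.cot ((n + 1) * θ),
      Real.cot ((n + 1 / 2) * θ) * Real.cot ((n + 1) * θ))) ''
    Set.Ioo (2 * n * Real.pi / (2 * n + 1)) ((2 * n + 1) * Real.pi / (2 * n + 2))

/-- The point `(a, b)` lies between the lower curve `L` and the upper curve `U`, or on one of them. -/
def LiesBetween (L U : Set (ℝ × ℝ)) (a b : ℝ) : Prop :=
  ∃ b₁ b₂ : ℝ, (a, b₁) ∈ L ∧ (a, b₂) ∈ U ∧ b₁ ≤ b ∧ b ≤ b₂

/-- The complex number `√(a(1+a+b)) + i√b`, of argument `θ/2` on the boundary curves. -/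
def thetaPhasor (a b : ℝ) : ℂ :=
  (Real.sqrt (a * (1 + a + b)) : ℂ) + Complex.I * (Real.sqrt b : ℂ)

/-- The complex number `√(b(1+a+b)) + i√a`. -/
def sidePhasor (a b : ℝ) : ℂ :=
  (Real.sqrt (b * (1 + a + b)) : ℂ) + Complex.I * (Real.sqrt a : ℂ)

end

/-!
Particle `1` takes part in every collision of the process, so the motion is governed by two relative
velocities after each collision: that of particle `1` to the particle it has just met
(`partnerVelocity`), and to the one it meets next (`targetVelocity`). Since the free flights bring
particle `1` from one partner to the other and back, a collision multiplies the velocity relative to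
its spectator by `-L k`, where `L k > 0` is the quotient of two successive times; capture says that
the last quotient is `0` (`IsCaptureProcess.exists_ratios`, and conversely `isCaptureProcess_of_ratios`).
Eliminating the velocities from two successive collisions shows that
`(1 - conj (x k)) (1 - x (k + 1))` is a positive number for `k ≥ 1`. So all phasors from the second on
have the same value `y` (`phasor_eq_of_real`), and
`(1 + L k) (1 + L (k + 1)) = 4 cos² ψ L k` with `4 cos² ψ = b |1 - y|² / ((a + b) (a + 1))`.
Counted from the end, the solution is `sin (j ψ) / sin ((j + 2) ψ)`; it is positive for all collisions
exactly if `(2n+1) ψ < π` (`angle_of_recurrence`). The angle of the theorem is `θ = π - 2ψ`. That the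
phasor of the first collision is a unit number is the equation for `θ` (`first_phasor_iff`,
`normSq_eq_iff`), and `|1 - y| ≤ 2` is the bound on `sin² (θ/2)`. This gives the description by angles,
`classicallyAllowed_iff`.

For the region, the bound is rewritten: for a solution of the equation it says that `a` is at most
`tan ψ cot (2nψ)` and at most `-tan ψ cot ((2n+2)ψ)` (`capture_bound_iff`). With equality in one of
the two places, `(a, b)` is on `C_{2n}` or `C_{2n+1}` (`mem_curveEven_iff`, `mem_curveOdd_iff`). As
`tan ψ cot (kψ)` and `sin ((2n+1)ψ) / sin ψ` decrease in `ψ` (`tan_mul_cot_strictAnti`,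
`sin_mul_quotient_strictAnti`), for fixed `a` the allowed `ψ` form the interval between the angles
of the two curves, and `b` decreases along it (`exists_isCaptureAngle_iff_liesBetween`).

On both curves `tan² ψ = a (1 + a + b) / b`, so that `ψ` is a function of `(a, b)`, and a curve is given by
one further trigonometric equation: the reality of a product of phasors, or, for small `n`, a polynomial
equation in `a` and `tan² ψ`.
-/

/-! ### Monotonicity of trigonometric quotients -/

lemma sin_add_two_mul (k : ℕ) (x : ℝ) :
    Real.sin ((k + 2 : ℕ) * x) = Real.sin (k * x) + 2 * Real.cos ((k + 1) * x) * Real.sin x := by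
  have h1 : ((k + 2 : ℕ) : ℝ) * x = (k + 1) * x + x := by push_cast; ring
  have h2 : (k : ℝ) * x = (k + 1) * x - x := by ring
  rw [h1, h2, Real.sin_add, Real.sin_sub]
  ring

/-- One step of the induction: adding `2 cos ((k + 1) x)` to `sin (k x) / sin x` makes it strictly
decreasing. -/
lemma sin_mul_quotient_step {k : ℕ} {x y : ℝ} (hx : 0 < x) (hxy : x < y)
    (hy : ((k + 2 : ℕ) : ℝ) * y ≤ Real.pi)
    (h : Real.sin (k * y) * Real.sin x ≤ Real.sin (k * x) * Real.sin y) :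
    Real.sin ((k + 2 : ℕ) * y) * Real.sin x < Real.sin ((k + 2 : ℕ) * x) * Real.sin y := by
  push_cast at hy
  have hk : (0 : ℝ) ≤ k := k.cast_nonneg
  have hky : 0 ≤ (k : ℝ) * y := by nlinarith
  have hsx : 0 < Real.sin x := Real.sin_pos_of_pos_of_lt_pi hx (by linarith)
  have hsy : 0 < Real.sin y := Real.sin_pos_of_pos_of_lt_pi (by linarith) (by linarith)
  have hc : Real.cos ((k + 1) * y) < Real.cos ((k + 1) * x) :=
    Real.cos_lt_cos_of_nonneg_of_le_pi (by positivity) (by linarith)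
      (mul_lt_mul_of_pos_left hxy (by positivity))
  rw [sin_add_two_mul, sin_add_two_mul]
  have := mul_lt_mul_of_pos_right hc (mul_pos hsx hsy)
  linarith

lemma sin_mul_quotient_antitone : ∀ {k : ℕ} {x y : ℝ}, 0 < x → x < y → (k : ℝ) * y ≤ Real.pi →
    Real.sin (k * y) * Real.sin x ≤ Real.sin (k * x) * Real.sin y
  | 0, x, y, _, _, _ => by simp
  | 1, x, y, _, _, _ => by simp [mul_comm]
  | k + 2, x, y, hx, hxy, hy => by
    refine (sin_mul_quotient_step hx hxy hy (sin_mul_quotient_antitone hx hxy ?_)).le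
    push_cast at hy
    linarith

/-- `sin (k x) / sin x` is strictly decreasing on `(0, π / k]`. -/
lemma sin_mul_quotient_strictAnti {k : ℕ} (hk : 2 ≤ k) {x y : ℝ} (hx : 0 < x) (hxy : x < y)
    (hy : (k : ℝ) * y ≤ Real.pi) :
    Real.sin (k * y) * Real.sin x < Real.sin (k * x) * Real.sin y := by
  obtain ⟨j, rfl⟩ := Nat.exists_eq_add_of_le' hk
  refine sin_mul_quotient_step hx hxy hy (sin_mul_quotient_antitone hx hxy ?_)
  push_cast at hy
  linarith

/-- `tan x * cot (k x)` is strictly decreasing on `(0, π / k)`. By the product formulas the claim for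
`x < y` is the comparison of `sin (k z) / sin z` at `z = y - x` and `z = x + y`. -/
lemma tan_mul_cot_strictAnti {k : ℕ} (hk : 2 ≤ k) {x y : ℝ} (hx : 0 < x) (hxy : x < y)
    (hy : (k : ℝ) * y < Real.pi) :
    Real.sin y * Real.cos (k * y) * (Real.cos x * Real.sin (k * x)) <
      Real.sin x * Real.cos (k * x) * (Real.cos y * Real.sin (k * y)) := by
  have hk' : (2 : ℝ) ≤ k := by exact_mod_cast hk
  have key : Real.sin (y - x) * Real.sin (k * (x + y)) <
      Real.sin (x + y) * Real.sin (k * (y - x)) := by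
    rcases le_or_gt ((k : ℝ) * (x + y)) Real.pi with h | h
    · have := sin_mul_quotient_strictAnti hk (sub_pos.2 hxy) (by linarith : y - x < x + y) h
      linarith
    · have hkx : (k : ℝ) * x < k * y := mul_lt_mul_of_pos_left hxy (by positivity)
      have hkx0 : 0 < (k : ℝ) * x := by positivity
      have hky2 : 2 * y ≤ k * y := mul_le_mul_of_nonneg_right hk' (by linarith)
      have h1 : Real.sin (k * (x + y)) < 0 := by
        have := Real.sin_pos_of_pos_of_lt_pi (x := k * (x + y) - Real.pi) (by linarith)
          (by rw [mul_add]; linarith)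
        rw [Real.sin_sub_pi] at this
        linarith
      have h2 : 0 < Real.sin (y - x) :=
        Real.sin_pos_of_pos_of_lt_pi (by linarith) (by linarith)
      have h3 : 0 < Real.sin (x + y) :=
        Real.sin_pos_of_pos_of_lt_pi (by linarith) (by linarith)
      have h4 : 0 < Real.sin (k * (y - x)) :=
        Real.sin_pos_of_pos_of_lt_pi (by rw [mul_sub]; linarith) (by rw [mul_sub]; linarith)
      nlinarith [mul_pos h3 h4, mul_pos h2 (neg_pos.2 h1)]
  rw [mul_add, mul_sub, Real.sin_sub, Real.sin_add, Real.sin_sub, Real.sin_add] at key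
  linarith

/-- If `tan x * cot (k x) ≤ a`, then `tan y * cot (k y) < a` for larger `y`, without denominators. -/
lemma lt_of_le_tan_mul_cot {k : ℕ} (hk : 2 ≤ k) {x y : ℝ} (a : ℝ) (hx : 0 < x) (hxy : x < y)
    (hy : (k : ℝ) * y < Real.pi)
    (h : Real.sin x * Real.cos (k * x) ≤ a * (Real.cos x * Real.sin (k * x))) :
    Real.sin y * Real.cos (k * y) < a * (Real.cos y * Real.sin (k * y)) := by
  have hk' : (2 : ℝ) ≤ k := by exact_mod_cast hk
  have hkx : (k : ℝ) * x < k * y := mul_lt_mul_of_pos_left hxy (by positivity)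
  have hky2 : 2 * y ≤ k * y := mul_le_mul_of_nonneg_right hk' (by linarith)
  have hcx : 0 < Real.cos x := Real.cos_pos_of_mem_Ioo ⟨by linarith, by linarith⟩
  have hcy : 0 < Real.cos y := Real.cos_pos_of_mem_Ioo ⟨by linarith, by linarith⟩
  have hsx : 0 < Real.sin (k * x) := Real.sin_pos_of_pos_of_lt_pi (by positivity) (by linarith)
  have hsy : 0 < Real.sin (k * y) :=
    Real.sin_pos_of_pos_of_lt_pi (by nlinarith) (by linarith)
  have h1 := tan_mul_cot_strictAnti hk hx hxy hy
  have h2 := mul_le_mul_of_nonneg_right h (mul_pos hcy hsy).le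
  have h3 := mul_pos hcx hsx
  refine lt_of_mul_lt_mul_right (h1.trans_le (h2.trans_eq ?_)) h3.le
  ring

/-! ### The complementary half angle -/

lemma cos_natCast_mul_pi_sub (n : ℕ) (x : ℝ) :
    Real.cos (n * Real.pi - x) = (-1) ^ n * Real.cos x := by
  rw [Real.cos_sub, Real.cos_nat_mul_pi, Real.sin_nat_mul_pi]; ring

lemma sin_natCast_mul_pi_sub (n : ℕ) (x : ℝ) :
    Real.sin (n * Real.pi - x) = -(-1) ^ n * Real.sin x := by
  rw [Real.sin_sub, Real.cos_nat_mul_pi, Real.sin_nat_mul_pi]; ring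

lemma cos_add_half_mul (n : ℕ) (ψ : ℝ) :
    Real.cos ((n + 1 / 2) * (Real.pi - 2 * ψ)) = (-1) ^ n * Real.sin ((2 * n + 1) * ψ) := by
  have h : ((n : ℝ) + 1 / 2) * (Real.pi - 2 * ψ) =
      n * Real.pi - ((2 * n + 1) * ψ - Real.pi / 2) := by ring
  rw [h, cos_natCast_mul_pi_sub, Real.cos_sub_pi_div_two]

lemma sin_add_half_mul (n : ℕ) (ψ : ℝ) :
    Real.sin ((n + 1 / 2) * (Real.pi - 2 * ψ)) = (-1) ^ n * Real.cos ((2 * n + 1) * ψ) := by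
  have h : ((n : ℝ) + 1 / 2) * (Real.pi - 2 * ψ) =
      n * Real.pi - ((2 * n + 1) * ψ - Real.pi / 2) := by ring
  rw [h, sin_natCast_mul_pi_sub, Real.sin_sub_pi_div_two]; ring

lemma cot_add_half_mul (n : ℕ) (ψ : ℝ) :
    Real.cot ((n + 1 / 2) * (Real.pi - 2 * ψ)) =
      Real.sin ((2 * n + 1) * ψ) / Real.cos ((2 * n + 1) * ψ) := by
  rw [Real.cot_eq_cos_div_sin, cos_add_half_mul, sin_add_half_mul,
    mul_div_mul_left _ _ (pow_ne_zero _ (by norm_num))]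

lemma cot_natCast_mul (n : ℕ) (ψ : ℝ) :
    Real.cot (n * (Real.pi - 2 * ψ)) = -(Real.cos (2 * n * ψ) / Real.sin (2 * n * ψ)) := by
  have h : (n : ℝ) * (Real.pi - 2 * ψ) = n * Real.pi - 2 * n * ψ := by ring
  rw [h, Real.cot_eq_cos_div_sin, cos_natCast_mul_pi_sub, sin_natCast_mul_pi_sub, neg_mul,
    div_neg, mul_div_mul_left _ _ (pow_ne_zero _ (by norm_num))]

lemma cot_half (ψ : ℝ) :
    Real.cot ((Real.pi - 2 * ψ) / 2) = Real.sin ψ / Real.cos ψ := by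
  have h : (Real.pi - 2 * ψ) / 2 = Real.pi / 2 - ψ := by ring
  rw [h, Real.cot_eq_cos_div_sin, Real.cos_pi_div_two_sub, Real.sin_pi_div_two_sub]

lemma mem_thetaInterval_iff (n : ℕ) (ψ : ℝ) :
    Real.pi - 2 * ψ ∈ thetaInterval n ↔ 0 < ψ ∧ (2 * n + 1) * ψ < Real.pi := by
  have hn : (0 : ℝ) < 2 * n + 1 := by positivity
  rw [thetaInterval, Set.mem_Ioo, div_lt_iff₀ hn]
  constructor
  · rintro ⟨h1, h2⟩
    exact ⟨by linarith, by linarith⟩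
  · rintro ⟨h1, h2⟩
    exact ⟨by linarith, by linarith⟩

lemma thetaEquation_iff {n : ℕ} {a b ψ : ℝ} (ha : 0 < a) (hb : 0 < b) (hs : 0 < Real.sin ψ) :
    ThetaEquation n a b (Real.pi - 2 * ψ) ↔
      Real.sin ((2 * n + 1) * ψ) ^ 2 * (a * (1 + b)) = b * (1 + a) * Real.sin ψ ^ 2 := by
  have h : (Real.pi - 2 * ψ) / 2 = Real.pi / 2 - ψ := by ring
  rw [ThetaEquation, cos_add_half_mul, h, Real.cos_pi_div_two_sub, mul_pow, ← pow_mul,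
    mul_comm n 2, pow_mul, neg_one_sq, one_pow, one_mul, div_eq_div_iff (by positivity)
    (by positivity)]

/-! ### The boundary curves -/

/-- The curve `C_{2n}` in terms of `ψ = (π - θ) / 2`: there `a = tan ψ cot (2nψ)` and
`b = a (1 + a) / (tan² ψ - a)`. Positivity of `a` and `b` encodes the range of the parameter. -/
lemma mem_curveEven_iff {n : ℕ} (hn : 1 ≤ n) {a b : ℝ} :
    (a, b) ∈ curveEven n ↔ 0 < a ∧ 0 < b ∧ ∃ ψ : ℝ, 0 < ψ ∧ 2 * n * ψ < Real.pi ∧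
      Real.sin ψ * Real.cos (2 * n * ψ) = a * (Real.cos ψ * Real.sin (2 * n * ψ)) ∧
      b * (Real.sin ψ ^ 2 - a * Real.cos ψ ^ 2) = a * (1 + a) * Real.cos ψ ^ 2 := by
  have hn' : (1 : ℝ) ≤ n := by exact_mod_cast hn
  have hadd : ∀ ψ : ℝ, (2 * (n : ℝ) + 1) * ψ = 2 * n * ψ + ψ := fun ψ => by ring
  have hle : ∀ ψ : ℝ, 0 < ψ → 2 * ψ ≤ 2 * n * ψ := fun ψ h0 =>
    mul_le_mul_of_nonneg_right (by linarith) h0.le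
  constructor
  · rintro ⟨θ, ⟨h1, h2⟩, h⟩
    obtain ⟨ψ, rfl⟩ : ∃ ψ, θ = Real.pi - 2 * ψ := ⟨(Real.pi - θ) / 2, by ring⟩
    rw [div_lt_iff₀ (by linarith)] at h1
    rw [lt_div_iff₀ (by linarith)] at h2
    have hψ : 0 < ψ := by nlinarith
    have hlt : 2 * n * ψ < Real.pi / 2 := by linarith
    have h3 := hle ψ hψ
    have hs : 0 < Real.sin ψ := Real.sin_pos_of_pos_of_lt_pi hψ (by linarith)
    have hc : 0 < Real.cos ψ := Real.cos_pos_of_mem_Ioo ⟨by linarith, by linarith⟩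
    have he : 0 < Real.sin (2 * n * ψ) :=
      Real.sin_pos_of_pos_of_lt_pi (by linarith) (by linarith)
    have hf : 0 < Real.cos (2 * n * ψ) := Real.cos_pos_of_mem_Ioo ⟨by linarith, by linarith⟩
    have hS : 0 < Real.sin ((2 * n + 1) * ψ) :=
      Real.sin_pos_of_pos_of_lt_pi (by positivity) (by linarith [hadd ψ])
    have hC : Real.cos ((2 * n + 1) * ψ) < 0 :=
      Real.cos_neg_of_pi_div_two_lt_of_lt (by linarith) (by linarith [hadd ψ])
    have hCe : Real.cos ((2 * n + 1) * ψ) = Real.cos (2 * n * ψ) * Real.cos ψ -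
        Real.sin (2 * n * ψ) * Real.sin ψ := by rw [hadd, Real.cos_add]
    have hSe : Real.sin ((2 * n + 1) * ψ) = Real.sin (2 * n * ψ) * Real.cos ψ +
        Real.cos (2 * n * ψ) * Real.sin ψ := by rw [hadd, Real.sin_add]
    simp only [Prod.mk.injEq, cot_half, cot_natCast_mul, cot_add_half_mul] at h
    obtain ⟨rfl, rfl⟩ := h
    have ha : -(Real.sin ψ / Real.cos ψ * -(Real.cos (2 * n * ψ) / Real.sin (2 * n * ψ))) =
        Real.sin ψ * Real.cos (2 * n * ψ) / (Real.cos ψ * Real.sin (2 * n * ψ)) := by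
      field_simp
    rw [ha]
    refine ⟨by positivity, ?_, ψ, hψ, by linarith, by field_simp, ?_⟩
    · rw [mul_neg, ← neg_mul]
      exact mul_pos (neg_pos.2 (div_neg_of_pos_of_neg hS hC)) (by positivity)
    · have hC' := hC.ne
      field_simp
      rw [hSe, hCe]
      ring
  · rintro ⟨ha, hb, ψ, hψ, hlt, h1, h2⟩
    have h3 := hle ψ hψ
    have hs : 0 < Real.sin ψ := Real.sin_pos_of_pos_of_lt_pi hψ (by linarith)
    have hc : 0 < Real.cos ψ := Real.cos_pos_of_mem_Ioo ⟨by linarith, by linarith⟩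
    have he : 0 < Real.sin (2 * n * ψ) :=
      Real.sin_pos_of_pos_of_lt_pi (by linarith) (by linarith)
    have hf : 0 < Real.cos (2 * n * ψ) := by
      have : 0 < a * (Real.cos ψ * Real.sin (2 * n * ψ)) := by positivity
      rw [← h1] at this
      exact pos_of_mul_pos_right this hs.le
    have hp : 0 < Real.sin ψ ^ 2 - a * Real.cos ψ ^ 2 := by
      have : 0 < a * (1 + a) * Real.cos ψ ^ 2 := by positivity
      rw [← h2] at this
      exact pos_of_mul_pos_right this hb.le
    have hCe : Real.cos ((2 * n + 1) * ψ) = Real.cos (2 * n * ψ) * Real.cos ψ -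
        Real.sin (2 * n * ψ) * Real.sin ψ := by rw [hadd, Real.cos_add]
    have hSe : Real.sin ((2 * n + 1) * ψ) = Real.sin (2 * n * ψ) * Real.cos ψ +
        Real.cos (2 * n * ψ) * Real.sin ψ := by rw [hadd, Real.sin_add]
    have hC : Real.cos ((2 * n + 1) * ψ) < 0 := by
      have : Real.cos ((2 * n + 1) * ψ) * Real.sin ψ =
          -((Real.sin ψ ^ 2 - a * Real.cos ψ ^ 2) * Real.sin (2 * n * ψ)) := by
        rw [hCe]; linear_combination Real.cos ψ * h1
      have h4 := mul_pos hp he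
      by_contra! h5
      nlinarith [mul_nonneg h5 hs.le]
    have hlt2 : 2 * n * ψ < Real.pi / 2 := by
      by_contra! h5
      linarith [Real.cos_nonpos_of_pi_div_two_le_of_le h5 (by linarith)]
    have hgt : Real.pi / 2 < (2 * n + 1) * ψ := by
      by_contra! h5
      linarith [Real.cos_nonneg_of_neg_pi_div_two_le_of_le
        (by linarith [hadd ψ] : -(Real.pi / 2) ≤ (2 * n + 1) * ψ) h5]
    refine ⟨Real.pi - 2 * ψ, ⟨?_, ?_⟩, ?_⟩
    · rw [div_lt_iff₀ (by linarith)]; linarith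
    · rw [lt_div_iff₀ (by linarith)]; linarith
    · simp only [Prod.mk.injEq, cot_half, cot_natCast_mul, cot_add_half_mul]
      have hC' := hC.ne
      have ha' : a = Real.sin ψ * Real.cos (2 * n * ψ) / (Real.cos ψ * Real.sin (2 * n * ψ)) := by
        rw [h1]; field_simp
      refine ⟨by rw [ha']; field_simp, mul_right_cancel₀ hp.ne' ?_⟩
      rw [h2, ha']
      field_simp
      rw [hSe, hCe]
      ring

/-- The curve `C_{2n+1}` in terms of `ψ = (π - θ) / 2`: there `a = -tan ψ cot ((2n+2)ψ)` and
`b = a (1 + a) / (tan² ψ - a)`. -/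
lemma mem_curveOdd_iff (n : ℕ) {a b : ℝ} :
    (a, b) ∈ curveOdd n ↔ 0 < a ∧ 0 < b ∧ ∃ ψ : ℝ, 0 < ψ ∧ (2 * n + 2) * ψ < Real.pi ∧
      Real.sin ψ * Real.cos ((2 * n + 2) * ψ) =
        -a * (Real.cos ψ * Real.sin ((2 * n + 2) * ψ)) ∧
      b * (Real.sin ψ ^ 2 - a * Real.cos ψ ^ 2) = a * (1 + a) * Real.cos ψ ^ 2 := by
  have hn' : (0 : ℝ) ≤ n := n.cast_nonneg
  have hadd : ∀ ψ : ℝ, (2 * (n : ℝ) + 1) * ψ = (2 * n + 2) * ψ - ψ := fun ψ => by ring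
  have hle : ∀ ψ : ℝ, 0 < ψ → 2 * ψ ≤ (2 * n + 2) * ψ := fun ψ h0 =>
    mul_le_mul_of_nonneg_right (by linarith) h0.le
  have hcot : ∀ ψ : ℝ, Real.cot (((n : ℝ) + 1) * (Real.pi - 2 * ψ)) =
      -(Real.cos ((2 * n + 2) * ψ) / Real.sin ((2 * n + 2) * ψ)) := fun ψ => by
    have := cot_natCast_mul (n + 1) ψ
    push_cast at this
    rw [this, mul_add, mul_one]
  constructor
  · rintro ⟨θ, ⟨h1, h2⟩, h⟩
    obtain ⟨ψ, rfl⟩ : ∃ ψ, θ = Real.pi - 2 * ψ := ⟨(Real.pi - θ) / 2, by ring⟩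
    rw [div_lt_iff₀ (by linarith)] at h1
    rw [lt_div_iff₀ (by linarith)] at h2
    have hψ : 0 < ψ := by nlinarith [Real.pi_pos]
    have h4 : (2 * n + 2) * ψ ≤ (2 * n + 1) * 2 * ψ :=
      mul_le_mul_of_nonneg_right (by linarith) hψ.le
    have hlt : (2 * n + 2) * ψ < Real.pi := by linarith
    have h3 := hle ψ hψ
    have hs : 0 < Real.sin ψ := Real.sin_pos_of_pos_of_lt_pi hψ (by linarith)
    have hc : 0 < Real.cos ψ := Real.cos_pos_of_mem_Ioo ⟨by linarith, by linarith⟩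
    have he : 0 < Real.sin ((2 * n + 2) * ψ) :=
      Real.sin_pos_of_pos_of_lt_pi (by linarith) (by linarith)
    have hf : Real.cos ((2 * n + 2) * ψ) < 0 :=
      Real.cos_neg_of_pi_div_two_lt_of_lt (by linarith) (by linarith)
    have hS : 0 < Real.sin ((2 * n + 1) * ψ) :=
      Real.sin_pos_of_pos_of_lt_pi (by positivity) (by linarith [hadd ψ])
    have hC : 0 < Real.cos ((2 * n + 1) * ψ) :=
      Real.cos_pos_of_mem_Ioo ⟨by linarith [hadd ψ], by linarith⟩
    have hCe : Real.cos ((2 * n + 1) * ψ) = Real.cos ((2 * n + 2) * ψ) * Real.cos ψ +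
        Real.sin ((2 * n + 2) * ψ) * Real.sin ψ := by rw [hadd, Real.cos_sub]
    have hSe : Real.sin ((2 * n + 1) * ψ) = Real.sin ((2 * n + 2) * ψ) * Real.cos ψ -
        Real.cos ((2 * n + 2) * ψ) * Real.sin ψ := by rw [hadd, Real.sin_sub]
    simp only [Prod.mk.injEq, cot_half, hcot, cot_add_half_mul] at h
    generalize hE : Real.sin ((2 * n + 2) * ψ) = e at *
    generalize hF : Real.cos ((2 * n + 2) * ψ) = f at *
    obtain ⟨rfl, rfl⟩ := h
    have ha : Real.sin ψ / Real.cos ψ * -(f / e) = -(Real.sin ψ * f / (Real.cos ψ * e)) := by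
      field_simp
    have hneg := div_neg_of_neg_of_pos hf he
    rw [ha]
    refine ⟨?_, mul_pos (div_pos hS hC) (neg_pos.2 hneg), ψ, hψ, hlt,
      by rw [hE, hF]; field_simp, ?_⟩
    · rw [← ha]
      exact mul_pos (div_pos hs hc) (neg_pos.2 hneg)
    · field_simp
      rw [hSe, hCe]
      ring
  · rintro ⟨ha, hb, ψ, hψ, hlt, h1, h2⟩
    have h3 := hle ψ hψ
    have hs : 0 < Real.sin ψ := Real.sin_pos_of_pos_of_lt_pi hψ (by linarith)
    have hc : 0 < Real.cos ψ := Real.cos_pos_of_mem_Ioo ⟨by linarith, by linarith⟩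
    have he : 0 < Real.sin ((2 * n + 2) * ψ) :=
      Real.sin_pos_of_pos_of_lt_pi (by linarith) (by linarith)
    have hf : Real.cos ((2 * n + 2) * ψ) < 0 := by
      have : 0 < a * (Real.cos ψ * Real.sin ((2 * n + 2) * ψ)) := by positivity
      by_contra! h5
      nlinarith [mul_nonneg h5 hs.le]
    have hp : 0 < Real.sin ψ ^ 2 - a * Real.cos ψ ^ 2 := by
      have : 0 < a * (1 + a) * Real.cos ψ ^ 2 := by positivity
      rw [← h2] at this
      exact pos_of_mul_pos_right this hb.le
    have hCe : Real.cos ((2 * n + 1) * ψ) = Real.cos ((2 * n + 2) * ψ) * Real.cos ψ +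
        Real.sin ((2 * n + 2) * ψ) * Real.sin ψ := by rw [hadd, Real.cos_sub]
    have hSe : Real.sin ((2 * n + 1) * ψ) = Real.sin ((2 * n + 2) * ψ) * Real.cos ψ -
        Real.cos ((2 * n + 2) * ψ) * Real.sin ψ := by rw [hadd, Real.sin_sub]
    have hC : 0 < Real.cos ((2 * n + 1) * ψ) := by
      have : Real.cos ((2 * n + 1) * ψ) * Real.sin ψ =
          (Real.sin ψ ^ 2 - a * Real.cos ψ ^ 2) * Real.sin ((2 * n + 2) * ψ) := by
        rw [hCe]; linear_combination Real.cos ψ * h1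
      refine pos_of_mul_pos_left (this ▸ mul_pos hp he) hs.le
    have hgt : Real.pi / 2 < (2 * n + 2) * ψ := by
      by_contra! h5
      linarith [Real.cos_nonneg_of_neg_pi_div_two_le_of_le
        (by linarith : -(Real.pi / 2) ≤ (2 * n + 2) * ψ) h5]
    have hlt2 : (2 * n + 1) * ψ < Real.pi / 2 := by
      by_contra! h5
      linarith [Real.cos_nonpos_of_pi_div_two_le_of_le h5 (by linarith [hadd ψ])]
    refine ⟨Real.pi - 2 * ψ, ⟨?_, ?_⟩, ?_⟩
    · rw [div_lt_iff₀ (by linarith)]; linarith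
    · rw [lt_div_iff₀ (by linarith)]; linarith
    · simp only [Prod.mk.injEq, cot_half, hcot, cot_add_half_mul]
      generalize Real.sin ((2 * n + 2) * ψ) = e at *
      generalize Real.cos ((2 * n + 2) * ψ) = f at *
      have ha' : a = -(Real.sin ψ * f / (Real.cos ψ * e)) := by
        rw [h1]; field_simp
      refine ⟨by rw [ha']; field_simp, mul_right_cancel₀ hp.ne' ?_⟩
      rw [h2, ha']
      field_simp
      rw [hSe, hCe]
      ring

/-! ### The allowed region -/

/-- `ψ = (π - θ) / 2` is the angle of a capture process: `θ` lies in the interval `I_n`, solves the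
equation for `θ`, and `sin² (θ / 2) ≤ b / ((a + b) (a + 1))`. -/
structure IsCaptureAngle (n : ℕ) (a b ψ : ℝ) : Prop where
  pos : 0 < ψ
  lt_pi : (2 * n + 1) * ψ < Real.pi
  equation : Real.sin ((2 * n + 1) * ψ) ^ 2 * (a * (1 + b)) = b * (1 + a) * Real.sin ψ ^ 2
  bound : Real.cos ψ ^ 2 * ((a + b) * (a + 1)) ≤ b

/-- The bound on the angle in a form that splits into two linear inequalities for `a`, according to the
sign of `C`. Here `s, c` and `S, C` stand for the sine and cosine of `ψ` and of `(2n+1)ψ`. -/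
lemma bound_iff_abs_le {a b s c S C : ℝ} (ha : 0 < a) (hb : 0 < b) (hs : 0 < s) (hc : 0 < c)
    (hS : 0 < S) (h1 : s ^ 2 + c ^ 2 = 1) (h2 : S ^ 2 + C ^ 2 = 1)
    (h : S ^ 2 * (a * (1 + b)) = b * (1 + a) * s ^ 2) :
    c ^ 2 * ((a + b) * (a + 1)) ≤ b ↔ (a + 1) * s * c * |C| ≤ (s ^ 2 - a * c ^ 2) * S := by
  have e1 : c ^ 2 * ((a + b) * (a + 1)) ≤ b ↔ a * (1 + a + b) * c ^ 2 ≤ b * s ^ 2 := by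
    have : b * s ^ 2 = b - b * c ^ 2 := by linear_combination b * h1
    rw [this]
    constructor <;> intro h <;> linarith
  -- after squaring, the two sides differ by a positive multiple of `b s² - a (1 + a + b) c²`
  have e2 : (((s ^ 2 - a * c ^ 2) * S) ^ 2 - ((a + 1) * s * c * |C|) ^ 2) * (a * (1 + b)) =
      (1 + a) * s ^ 2 * (b * s ^ 2 - a * (1 + a + b) * c ^ 2) := by
    have hC : |C| ^ 2 = 1 - S ^ 2 := by rw [sq_abs]; linarith
    have hs2 : s ^ 2 = 1 - c ^ 2 := by linarith
    rw [mul_pow _ S, mul_pow _ |C|, hC]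
    have : ((s ^ 2 - a * c ^ 2) ^ 2 * S ^ 2 - ((a + 1) * s * c) ^ 2 * (1 - S ^ 2)) *
        (a * (1 + b)) = ((s ^ 2 - a * c ^ 2) ^ 2 + ((a + 1) * s * c) ^ 2) *
          (S ^ 2 * (a * (1 + b))) - ((a + 1) * s * c) ^ 2 * (a * (1 + b)) := by ring
    rw [this, h]
    have : ((a + 1) * s * c) ^ 2 = (a + 1) ^ 2 * s ^ 2 * c ^ 2 := by ring
    rw [this, hs2]
    ring
  rw [e1]
  constructor
  · intro h3
    have h4 : 0 ≤ s ^ 2 - a * c ^ 2 := by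
      have : 0 < a * (1 + a) * c ^ 2 := by positivity
      by_contra! h5
      nlinarith
    refine abs_le_of_sq_le_sq' ?_ (by positivity) |>.2
    have : 0 ≤ (1 + a) * s ^ 2 * (b * s ^ 2 - a * (1 + a + b) * c ^ 2) :=
      mul_nonneg (by positivity) (by linarith)
    rw [← e2] at this
    linarith [nonneg_of_mul_nonneg_left this (by positivity)]
  · intro h3
    have h4 := pow_le_pow_left₀ (by positivity) h3 2
    have : 0 ≤ (1 + a) * s ^ 2 * (b * s ^ 2 - a * (1 + a + b) * c ^ 2) := by
      rw [← e2]
      exact mul_nonneg (by linarith) (by positivity)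
    linarith [nonneg_of_mul_nonneg_right this (by positivity)]

/-- The difference of `a` and `tan ψ cot (x - ψ)`, with denominators cleared, in terms of the sine and
cosine of `x`. -/
lemma expand_sub_angle (x ψ a : ℝ) :
    a * (Real.cos ψ * Real.sin (x - ψ)) - Real.sin ψ * Real.cos (x - ψ) =
      (a * Real.cos ψ ^ 2 - Real.sin ψ ^ 2) * Real.sin x -
        (a + 1) * Real.sin ψ * Real.cos ψ * Real.cos x := by
  rw [Real.sin_sub, Real.cos_sub]; ring

/-- The difference of `a` and `-tan ψ cot (x + ψ)`, with denominators cleared, in terms of the sine and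
cosine of `x`. -/
lemma expand_add_angle (x ψ a : ℝ) :
    a * (Real.cos ψ * Real.sin (x + ψ)) + Real.sin ψ * Real.cos (x + ψ) =
      (a * Real.cos ψ ^ 2 - Real.sin ψ ^ 2) * Real.sin x +
        (a + 1) * Real.sin ψ * Real.cos ψ * Real.cos x := by
  rw [Real.sin_add, Real.cos_add]; ring

/-- The angle of a point of one of the two curves solves the equation for the angle. -/
lemma equation_of_sq_eq {a b s c S C : ℝ} (hp : 0 < s ^ 2 - a * c ^ 2)
    (h1 : s ^ 2 + c ^ 2 = 1) (h2 : S ^ 2 + C ^ 2 = 1)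
    (h3 : ((s ^ 2 - a * c ^ 2) * S) ^ 2 = ((a + 1) * s * c * C) ^ 2)
    (h4 : b * (s ^ 2 - a * c ^ 2) = a * (1 + a) * c ^ 2) :
    S ^ 2 * (a * (1 + b)) = b * (1 + a) * s ^ 2 := by
  refine mul_right_cancel₀ hp.ne' ?_
  have e1 : (1 + b) * (s ^ 2 - a * c ^ 2) = s ^ 2 + a ^ 2 * c ^ 2 := by
    linear_combination h4
  have e2 : S ^ 2 * (s ^ 2 + a ^ 2 * c ^ 2) = (a + 1) ^ 2 * s ^ 2 * c ^ 2 := by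
    have hC : C ^ 2 = 1 - S ^ 2 := by linarith
    have : ((s ^ 2 - a * c ^ 2) ^ 2 + ((a + 1) * s * c) ^ 2) =
        (s ^ 2 + c ^ 2) * (s ^ 2 + a ^ 2 * c ^ 2) := by ring
    rw [h1] at this
    rw [mul_pow, mul_pow _ C, hC] at h3
    linear_combination h3 - S ^ 2 * this
  linear_combination a * S ^ 2 * e1 + a * e2 - (1 + a) * s ^ 2 * h4

/-- For solutions of the equation for the angle, the bound on the angle compares `a` with the values
`tan ψ cot (2nψ)` and `-tan ψ cot ((2n+2)ψ)` that it has on the two curves. -/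
lemma capture_bound_iff {n : ℕ} (hn : 1 ≤ n) {a b ψ : ℝ} (ha : 0 < a) (hb : 0 < b) (hψ : 0 < ψ)
    (hlt : (2 * n + 1) * ψ < Real.pi)
    (h : Real.sin ((2 * n + 1) * ψ) ^ 2 * (a * (1 + b)) = b * (1 + a) * Real.sin ψ ^ 2) :
    Real.cos ψ ^ 2 * ((a + b) * (a + 1)) ≤ b ↔
      a * (Real.cos ψ * Real.sin (2 * n * ψ)) ≤ Real.sin ψ * Real.cos (2 * n * ψ) ∧
      Real.sin ψ * Real.cos ((2 * n + 2) * ψ) ≤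
        -a * (Real.cos ψ * Real.sin ((2 * n + 2) * ψ)) := by
  have hn' : (1 : ℝ) ≤ n := by exact_mod_cast hn
  have h3 : 3 * ψ ≤ (2 * n + 1) * ψ := mul_le_mul_of_nonneg_right (by linarith) hψ.le
  have hs : 0 < Real.sin ψ := Real.sin_pos_of_pos_of_lt_pi hψ (by linarith)
  have hc : 0 < Real.cos ψ := Real.cos_pos_of_mem_Ioo ⟨by linarith, by linarith⟩
  have hS : 0 < Real.sin ((2 * n + 1) * ψ) :=
    Real.sin_pos_of_pos_of_lt_pi (by positivity) hlt
  have e1 : 2 * (n : ℝ) * ψ = (2 * n + 1) * ψ - ψ := by ring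
  have e2 : (2 * (n : ℝ) + 2) * ψ = (2 * n + 1) * ψ + ψ := by ring
  have h1 := expand_sub_angle ((2 * n + 1) * ψ) ψ a
  have h2 := expand_add_angle ((2 * n + 1) * ψ) ψ a
  rw [bound_iff_abs_le ha hb hs hc hS (Real.sin_sq_add_cos_sq ψ) (Real.sin_sq_add_cos_sq _) h,
    e1, e2, ← abs_of_pos (by positivity : 0 < (a + 1) * Real.sin ψ * Real.cos ψ), ← abs_mul,
    abs_le]
  constructor
  · rintro ⟨h4, h5⟩
    exact ⟨by linarith, by linarith⟩
  · rintro ⟨h4, h5⟩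
    exact ⟨by linarith, by linarith⟩

lemma sq_sub_mul_sq_pos {a b s c : ℝ} (ha : 0 < a) (hb : 0 < b) (hc : 0 < c)
    (h : b * (s ^ 2 - a * c ^ 2) = a * (1 + a) * c ^ 2) : 0 < s ^ 2 - a * c ^ 2 := by
  have : 0 < a * (1 + a) * c ^ 2 := by positivity
  rw [← h] at this
  exact pos_of_mul_pos_right this hb.le

lemma equation_of_even {n : ℕ} {a b ψ : ℝ} (ha : 0 < a) (hb : 0 < b) (hc : 0 < Real.cos ψ)
    (h1 : Real.sin ψ * Real.cos (2 * n * ψ) = a * (Real.cos ψ * Real.sin (2 * n * ψ)))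
    (h2 : b * (Real.sin ψ ^ 2 - a * Real.cos ψ ^ 2) = a * (1 + a) * Real.cos ψ ^ 2) :
    Real.sin ((2 * n + 1) * ψ) ^ 2 * (a * (1 + b)) = b * (1 + a) * Real.sin ψ ^ 2 := by
  refine equation_of_sq_eq (sq_sub_mul_sq_pos ha hb hc h2) (Real.sin_sq_add_cos_sq ψ)
    (Real.sin_sq_add_cos_sq _) ?_ h2
  have e1 : 2 * (n : ℝ) * ψ = (2 * n + 1) * ψ - ψ := by ring
  have h3 := expand_sub_angle ((2 * n + 1) * ψ) ψ a
  rw [← e1, h1, sub_self] at h3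
  rw [sq_eq_sq_iff_eq_or_eq_neg]
  right
  linarith

lemma equation_of_odd {n : ℕ} {a b ψ : ℝ} (ha : 0 < a) (hb : 0 < b) (hc : 0 < Real.cos ψ)
    (h1 : Real.sin ψ * Real.cos ((2 * n + 2) * ψ) =
      -a * (Real.cos ψ * Real.sin ((2 * n + 2) * ψ)))
    (h2 : b * (Real.sin ψ ^ 2 - a * Real.cos ψ ^ 2) = a * (1 + a) * Real.cos ψ ^ 2) :
    Real.sin ((2 * n + 1) * ψ) ^ 2 * (a * (1 + b)) = b * (1 + a) * Real.sin ψ ^ 2 := by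
  refine equation_of_sq_eq (sq_sub_mul_sq_pos ha hb hc h2) (Real.sin_sq_add_cos_sq ψ)
    (Real.sin_sq_add_cos_sq _) ?_ h2
  have e1 : (2 * (n : ℝ) + 2) * ψ = (2 * n + 1) * ψ + ψ := by ring
  have h3 := expand_add_angle ((2 * n + 1) * ψ) ψ a
  rw [← e1, h1] at h3
  rw [sq_eq_sq_iff_eq_or_eq_neg]
  left
  linarith

/-- For fixed `a`, the solution of the equation for the angle determines `b`, and `b` decreases as `ψ`
grows. -/
lemma le_of_angle_le {n : ℕ} {a b₁ b₂ x y : ℝ} (ha : 0 < a) (hb₁ : 0 < b₁) (hb₂ : 0 < b₂)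
    (hn : 1 ≤ n) (hx : 0 < x) (hxy : x ≤ y) (hy : (2 * n + 1) * y < Real.pi)
    (h₁ : Real.sin ((2 * n + 1) * x) ^ 2 * (a * (1 + b₁)) = b₁ * (1 + a) * Real.sin x ^ 2)
    (h₂ : Real.sin ((2 * n + 1) * y) ^ 2 * (a * (1 + b₂)) = b₂ * (1 + a) * Real.sin y ^ 2) :
    b₂ ≤ b₁ := by
  have hn' : (1 : ℝ) ≤ n := by exact_mod_cast hn
  have h3 : 3 * y ≤ (2 * n + 1) * y := mul_le_mul_of_nonneg_right (by linarith) (by linarith)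
  have hsx : 0 < Real.sin x := Real.sin_pos_of_pos_of_lt_pi hx (by linarith)
  have hsy : 0 < Real.sin y := Real.sin_pos_of_pos_of_lt_pi (by linarith) (by linarith)
  have hSy : 0 < Real.sin ((2 * n + 1) * y) :=
    Real.sin_pos_of_pos_of_lt_pi (mul_pos (by linarith) (by linarith)) hy
  have hle : Real.sin ((2 * n + 1) * y) * Real.sin x ≤
      Real.sin ((2 * n + 1) * x) * Real.sin y := by
    rcases hxy.eq_or_lt with rfl | hxy
    · exact le_rfl
    · have := sin_mul_quotient_antitone (k := 2 * n + 1) hx hxy (by push_cast; exact hy.le)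
      push_cast at this
      exact this
  have h4 := pow_le_pow_left₀ (by positivity) hle 2
  rw [mul_pow, mul_pow] at h4
  have h5 := mul_le_mul_of_nonneg_right h4 (by positivity : 0 ≤ a * ((1 + b₁) * (1 + b₂)))
  have h6 : b₂ * (1 + b₁) * ((1 + a) * Real.sin x ^ 2 * Real.sin y ^ 2) ≤
      b₁ * (1 + b₂) * ((1 + a) * Real.sin x ^ 2 * Real.sin y ^ 2) := by
    linear_combination h5 - Real.sin x ^ 2 * (1 + b₁) * h₂ + Real.sin y ^ 2 * (1 + b₂) * h₁
  have h7 := le_of_mul_le_mul_right h6 (by positivity)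
  linarith

/-- The equation for the angle has at most one solution. -/
lemma angle_unique {n : ℕ} (hn : 1 ≤ n) {a b x y : ℝ} (ha : 0 < a) (hb : 0 < b)
    (hx : 0 < x) (hxy : x < y) (hy : (2 * n + 1) * y < Real.pi)
    (h₁ : Real.sin ((2 * n + 1) * x) ^ 2 * (a * (1 + b)) = b * (1 + a) * Real.sin x ^ 2)
    (h₂ : Real.sin ((2 * n + 1) * y) ^ 2 * (a * (1 + b)) = b * (1 + a) * Real.sin y ^ 2) :
    False := by
  have hn' : (1 : ℝ) ≤ n := by exact_mod_cast hn
  have h3 : 3 * y ≤ (2 * n + 1) * y := mul_le_mul_of_nonneg_right (by linarith) (by linarith)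
  have hsx : 0 < Real.sin x := Real.sin_pos_of_pos_of_lt_pi hx (by linarith)
  have hSy : 0 < Real.sin ((2 * n + 1) * y) :=
    Real.sin_pos_of_pos_of_lt_pi (mul_pos (by linarith) (by linarith)) hy
  have hle := sin_mul_quotient_strictAnti (k := 2 * n + 1) (by omega) hx hxy
    (by push_cast; exact hy.le)
  push_cast at hle
  have h4 := pow_lt_pow_left₀ hle (by positivity) two_ne_zero
  rw [mul_pow, mul_pow] at h4
  have h5 := mul_lt_mul_of_pos_right h4 (by positivity : 0 < a * (1 + b))
  refine absurd h5 (not_lt.2 (le_of_eq ?_))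
  linear_combination Real.sin y ^ 2 * h₁ - Real.sin x ^ 2 * h₂

/-- On the vertical line through `(a, b)`, a capture angle is enclosed by the angles of a point of
`C_{2n+1}` and a point of `C_{2n}`; both are found by the intermediate value theorem, starting from the
angle `π / (4n+2)` at which both curves run off to infinity. -/
lemma IsCaptureAngle.liesBetween {n : ℕ} (hn : 1 ≤ n) {a b ψ : ℝ} (ha : 0 < a) (hb : 0 < b)
    (h : IsCaptureAngle n a b ψ) : LiesBetween (curveEven n) (curveOdd n) a b := by
  have hn' : (1 : ℝ) ≤ n := by exact_mod_cast hn
  obtain ⟨hψ, hlt, heq, hbd⟩ := h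
  obtain ⟨hX, hY⟩ := (capture_bound_iff hn ha hb hψ hlt heq).1 hbd
  have hpi := Real.pi_pos
  have h3 : 3 * ψ ≤ (2 * n + 1) * ψ := mul_le_mul_of_nonneg_right (by linarith) hψ.le
  have hs : 0 < Real.sin ψ := Real.sin_pos_of_pos_of_lt_pi hψ (by linarith)
  have hc : 0 < Real.cos ψ := Real.cos_pos_of_mem_Ioo ⟨by linarith, by linarith⟩
  have hp : 0 < Real.sin ψ ^ 2 - a * Real.cos ψ ^ 2 := by
    have h4 : 0 < a * (1 + a) * Real.cos ψ ^ 2 := by positivity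
    have h5 : b * Real.sin ψ ^ 2 = b - b * Real.cos ψ ^ 2 := by rw [Real.sin_sq]; ring
    have h6 : 0 < b * (Real.sin ψ ^ 2 - a * Real.cos ψ ^ 2) := by linarith
    exact pos_of_mul_pos_right h6 hb.le
  obtain ⟨z, hz⟩ : ∃ z : ℝ, (2 * n + 1) * z = Real.pi / 2 :=
    ⟨Real.pi / 2 / (2 * n + 1), mul_div_cancel₀ _ (by positivity)⟩
  obtain ⟨r, hr⟩ : ∃ r : ℝ, 2 * n * r = Real.pi / 2 :=
    ⟨Real.pi / 2 / (2 * n), mul_div_cancel₀ _ (by positivity)⟩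
  obtain ⟨l, hl⟩ : ∃ l : ℝ, (2 * n + 2) * l = Real.pi / 2 :=
    ⟨Real.pi / 2 / (2 * n + 2), mul_div_cancel₀ _ (by positivity)⟩
  have hz0 : 0 < z := by nlinarith
  have hl0 : 0 < l := by nlinarith
  have hr0 : 0 < r := by nlinarith
  have hzr : z < r := by nlinarith
  have hlz : l < z := by nlinarith
  have hr4 : r ≤ Real.pi / 4 := by nlinarith
  have hcz : 0 < Real.cos z := Real.cos_pos_of_mem_Ioo ⟨by linarith, by linarith⟩
  have e1 : ∀ x : ℝ, 2 * (n : ℝ) * x = (2 * n + 1) * x - x := fun x => by ring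
  have e2 : ∀ x : ℝ, (2 * (n : ℝ) + 2) * x = (2 * n + 1) * x + x := fun x => by ring
  have hz1 : Real.cos (2 * n * z) = Real.sin z ∧ Real.sin (2 * n * z) = Real.cos z := by
    rw [e1, hz, Real.cos_pi_div_two_sub, Real.sin_pi_div_two_sub]
    exact ⟨rfl, rfl⟩
  have hz2 : Real.cos ((2 * n + 2) * z) = -Real.sin z ∧
      Real.sin ((2 * n + 2) * z) = Real.cos z := by
    rw [e2, hz, add_comm, Real.cos_add_pi_div_two, Real.sin_add_pi_div_two]
    exact ⟨rfl, rfl⟩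
  -- the value of `a` at which the curves run off to infinity is `tan² z`
  have hza : a * Real.cos z ^ 2 < Real.sin z ^ 2 := by
    rcases le_or_gt ψ z with hle | hgt
    · have h4 : Real.sin ψ ≤ Real.sin z :=
        Real.sin_le_sin_of_le_of_le_pi_div_two (by linarith) (by linarith) hle
      have h5 : Real.cos z ≤ Real.cos ψ :=
        Real.cos_le_cos_of_nonneg_of_le_pi hψ.le (by linarith) hle
      have h6 := pow_le_pow_left₀ hs.le h4 2
      have h7 := mul_le_mul_of_nonneg_left (pow_le_pow_left₀ hcz.le h5 2) ha.le
      linarith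
    · by_contra! h4
      have := lt_of_le_tan_mul_cot (k := 2 * n) (by omega) a hz0 hgt
        (by push_cast; linarith [e1 ψ]) (by push_cast; rw [hz1.1, hz1.2]; linarith)
      push_cast at this
      linarith
  obtain ⟨x, ⟨hzx, hxr⟩, hx⟩ : ∃ x ∈ Set.Icc z r,
      Real.sin x * Real.cos (2 * n * x) - a * (Real.cos x * Real.sin (2 * n * x)) = 0 := by
    refine intermediate_value_Icc' hzr.le (Continuous.continuousOn (by fun_prop)) ⟨?_, ?_⟩
    · rw [hr, Real.cos_pi_div_two, Real.sin_pi_div_two]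
      have := Real.cos_pos_of_mem_Ioo (⟨by linarith, by linarith⟩ : r ∈ Set.Ioo _ _)
      have := mul_pos ha this
      linarith
    · rw [hz1.1, hz1.2]; linarith
  obtain ⟨w, ⟨hlw, hwz⟩, hw⟩ : ∃ w ∈ Set.Icc l z,
      -a * (Real.cos w * Real.sin ((2 * n + 2) * w)) -
        Real.sin w * Real.cos ((2 * n + 2) * w) = 0 := by
    refine intermediate_value_Icc hlz.le (Continuous.continuousOn (by fun_prop)) ⟨?_, ?_⟩
    · rw [hl, Real.cos_pi_div_two, Real.sin_pi_div_two]
      have := Real.cos_pos_of_mem_Ioo (⟨by linarith, by linarith⟩ : l ∈ Set.Ioo _ _)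
      have := mul_pos ha this
      linarith
    · rw [hz2.1, hz2.2]; linarith
  have hcx : 0 < Real.cos x := Real.cos_pos_of_mem_Ioo ⟨by linarith, by linarith⟩
  have hcw : 0 < Real.cos w := Real.cos_pos_of_mem_Ioo ⟨by linarith, by linarith⟩
  -- `tan x` and `tan w` are large enough for `b = a (1 + a) / (tan² - a)` to be positive
  have hpx : 0 < Real.sin x ^ 2 - a * Real.cos x ^ 2 := by
    have h4 : Real.sin z ≤ Real.sin x :=
      Real.sin_le_sin_of_le_of_le_pi_div_two (by linarith) (by linarith) hzx
    have h5 : Real.cos x ≤ Real.cos z :=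
      Real.cos_le_cos_of_nonneg_of_le_pi hz0.le (by linarith) hzx
    have h6 := pow_le_pow_left₀
      (Real.sin_nonneg_of_nonneg_of_le_pi hz0.le (by linarith)) h4 2
    have h7 := mul_le_mul_of_nonneg_left (pow_le_pow_left₀ hcx.le h5 2) ha.le
    linarith
  have hpw : 0 < Real.sin w ^ 2 - a * Real.cos w ^ 2 := by
    have hwz' : w ≠ z := by
      rintro rfl
      rw [hz2.1, hz2.2] at hw
      linarith
    have hwz' := lt_of_le_of_ne hwz hwz'
    have hw1 : (2 * n + 1) * w < Real.pi / 2 := hz ▸ mul_lt_mul_of_pos_left hwz' (by linarith)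
    have hw0 : 0 < (2 * n + 1) * w := mul_pos (by linarith) (by linarith)
    have hSw : 0 < Real.sin ((2 * n + 1) * w) :=
      Real.sin_pos_of_pos_of_lt_pi hw0 (by linarith)
    have hCw : 0 < Real.cos ((2 * n + 1) * w) :=
      Real.cos_pos_of_mem_Ioo ⟨by linarith, by linarith⟩
    have hsw : 0 < Real.sin w := Real.sin_pos_of_pos_of_lt_pi (by linarith) (by linarith)
    have h4 := expand_add_angle ((2 * n + 1) * w) w a
    rw [← e2] at h4
    have h5 : 0 < (Real.sin w ^ 2 - a * Real.cos w ^ 2) * Real.sin ((2 * n + 1) * w) := by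
      have : 0 < (a + 1) * Real.sin w * Real.cos w * Real.cos ((2 * n + 1) * w) := by positivity
      linarith
    exact pos_of_mul_pos_left h5 hSw.le
  have hb1 := div_mul_cancel₀ (a * (1 + a) * Real.cos x ^ 2) hpx.ne'
  have hb2 := div_mul_cancel₀ (a * (1 + a) * Real.cos w ^ 2) hpw.ne'
  have hb1p : 0 < a * (1 + a) * Real.cos x ^ 2 / (Real.sin x ^ 2 - a * Real.cos x ^ 2) := by
    positivity
  have hb2p : 0 < a * (1 + a) * Real.cos w ^ 2 / (Real.sin w ^ 2 - a * Real.cos w ^ 2) := by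
    positivity
  have hxe := equation_of_even ha hb1p hcx (sub_eq_zero.1 hx) hb1
  have hwe := equation_of_odd ha hb2p hcw (sub_eq_zero.1 hw).symm hb2
  have hx2 : 2 * n * x ≤ Real.pi / 2 := hr ▸ mul_le_mul_of_nonneg_left hxr (by linarith)
  have hw2 : (2 * n + 1) * w ≤ Real.pi / 2 := hz ▸ mul_le_mul_of_nonneg_left hwz (by linarith)
  refine ⟨_, _, (mem_curveEven_iff hn).2 ⟨ha, hb1p, x, by linarith, by linarith,
    sub_eq_zero.1 hx, hb1⟩, (mem_curveOdd_iff n).2 ⟨ha, hb2p, w, by linarith, by linarith [e2 w],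
    (sub_eq_zero.1 hw).symm, hb2⟩, ?_, ?_⟩
  · refine le_of_angle_le ha hb hb1p hn hψ ?_ (by linarith [e1 x]) heq hxe
    by_contra! hlt'
    have := lt_of_le_tan_mul_cot (k := 2 * n) (by omega) a (by linarith) hlt'
      (by push_cast; linarith [e1 ψ]) (by push_cast; linarith)
    push_cast at this
    linarith
  · refine le_of_angle_le ha hb2p hb hn (by linarith) ?_ hlt hwe heq
    by_contra! hlt'
    have := lt_of_le_tan_mul_cot (k := 2 * n + 2) (by omega) (-a) hψ hlt'
      (by push_cast; linarith [e2 w]) (by push_cast; linarith)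
    push_cast at this
    linarith

lemma exists_isCaptureAngle_iff_liesBetween {n : ℕ} (hn : 1 ≤ n) {a b : ℝ} (ha : 0 < a)
    (hb : 0 < b) :
    (∃ ψ, IsCaptureAngle n a b ψ) ↔ LiesBetween (curveEven n) (curveOdd n) a b := by
  refine ⟨fun ⟨ψ, h⟩ => h.liesBetween hn ha hb, ?_⟩
  rintro ⟨b₁, b₂, h₁, h₂, hb₁, hb₂⟩
  have hn' : (1 : ℝ) ≤ n := by exact_mod_cast hn
  obtain ⟨-, hb1p, x, hx0, hx, hX, hbx⟩ := (mem_curveEven_iff hn).1 h₁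
  obtain ⟨-, hb2p, w, hw0, hw, hY, hbw⟩ := (mem_curveOdd_iff n).1 h₂
  have e1 : ∀ x : ℝ, 2 * (n : ℝ) * x = (2 * n + 1) * x - x := fun x => by ring
  have e2 : ∀ x : ℝ, (2 * (n : ℝ) + 2) * x = (2 * n + 1) * x + x := fun x => by ring
  have hx2 : 2 * x ≤ 2 * n * x := mul_le_mul_of_nonneg_right (by linarith) hx0.le
  have hw2 : 4 * w ≤ (2 * n + 2) * w := mul_le_mul_of_nonneg_right (by linarith) hw0.le
  have hsx : 0 < Real.sin x := Real.sin_pos_of_pos_of_lt_pi hx0 (by linarith)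
  have hsw : 0 < Real.sin w := Real.sin_pos_of_pos_of_lt_pi hw0 (by linarith)
  have hcx : 0 < Real.cos x := Real.cos_pos_of_mem_Ioo ⟨by linarith, by linarith⟩
  have hcw : 0 < Real.cos w := Real.cos_pos_of_mem_Ioo ⟨by linarith, by linarith⟩
  have hx' : 2 * n * x < Real.pi / 2 := by
    have h3 : 0 < Real.sin (2 * n * x) :=
      Real.sin_pos_of_pos_of_lt_pi (by linarith) hx
    by_contra! h4
    have h5 := Real.cos_nonpos_of_pi_div_two_le_of_le h4 (by linarith)
    nlinarith [mul_pos ha (mul_pos hcx h3)]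
  have hxe := equation_of_even ha hb1p hcx hX hbx
  have hwe := equation_of_odd ha hb2p hcw hY hbw
  have hwx : w ≤ x := by
    by_contra! h3
    have h4 : b₁ = b₂ := le_antisymm (hb₁.trans hb₂)
      (le_of_angle_le ha hb1p hb2p hn hx0 h3.le (by linarith [e2 w]) hxe hwe)
    subst h4
    exact angle_unique hn ha hb1p hx0 h3 (by linarith [e2 w]) hxe hwe
  obtain ⟨ψ, ⟨hwψ, hψx⟩, hψ⟩ : ∃ ψ ∈ Set.Icc w x,
      Real.sin ((2 * n + 1) * ψ) ^ 2 * (a * (1 + b)) - b * (1 + a) * Real.sin ψ ^ 2 = 0 := by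
    refine intermediate_value_Icc' hwx (Continuous.continuousOn (by fun_prop)) ⟨?_, ?_⟩
    · have h3 : 0 ≤ (1 + a) * Real.sin x ^ 2 * (b - b₁) :=
        mul_nonneg (by positivity) (by linarith)
      refine nonpos_of_mul_nonpos_left (b := 1 + b₁) ?_ (by positivity)
      linear_combination h3 + (1 + b) * hxe
    · have h3 : 0 ≤ (1 + a) * Real.sin w ^ 2 * (b₂ - b) :=
        mul_nonneg (by positivity) (by linarith)
      refine nonneg_of_mul_nonneg_left (b := 1 + b₂) ?_ (by positivity)
      linear_combination h3 - (1 + b) * hwe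
  have hψ0 : 0 < ψ := by linarith
  have hψ1 : 2 * n * ψ ≤ 2 * n * x := mul_le_mul_of_nonneg_left hψx (by linarith)
  have hψ2 : 2 * ψ ≤ 2 * n * ψ := mul_le_mul_of_nonneg_right (by linarith) hψ0.le
  have heq := sub_eq_zero.1 hψ
  refine ⟨ψ, hψ0, by linarith [e1 ψ], heq,
    (capture_bound_iff hn ha hb hψ0 (by linarith [e1 ψ]) heq).2 ⟨?_, ?_⟩⟩
  · rcases hψx.eq_or_lt with rfl | hlt
    · exact hX.ge
    · by_contra! h3
      have := lt_of_le_tan_mul_cot (k := 2 * n) (by omega) a hψ0 hlt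
        (by push_cast; linarith) (by push_cast; linarith)
      push_cast at this
      linarith
  · rcases hwψ.eq_or_lt with rfl | hlt
    · exact hY.le
    · have := lt_of_le_tan_mul_cot (k := 2 * n + 2) (by omega) (-a) hw0 hlt
        (by push_cast; linarith [e1 ψ, e2 ψ]) (by push_cast; linarith)
      push_cast at this
      linarith

/-! ### The relative velocities -/

lemma collisions232_add_two (k : ℕ) : collisions232 (k + 2) = collisions232 k := by
  simp [collisions232, Nat.even_add]

lemma collisions232_ne_zero (k : ℕ) : (0 : Fin 3) ≠ collisions232 k := by
  unfold collisions232
  split_ifs <;> decide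

lemma collisions232_succ_ne (k : ℕ) : collisions232 (k + 1) ≠ collisions232 k := by
  unfold collisions232
  rcases Nat.even_or_odd k with h | h
  · simp [h, Nat.even_add_one]
  · simp [Nat.even_add_one, Nat.not_even_iff_odd.2 h]

/-- The share of the partner of particle `1` in the mass of the pair that undergoes collision `k`. -/
noncomputable def partnerMassFraction (a b : ℝ) (k : ℕ) : ℝ := if Even k then b / (a + b) else 1 / (1 + a)

lemma partnerMassFraction_zero (a b : ℝ) : partnerMassFraction a b 0 = b / (a + b) := by
  simp [partnerMassFraction]

lemma partnerMassFraction_one (a b : ℝ) : partnerMassFraction a b 1 = 1 / (1 + a) := by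
  simp [partnerMassFraction]

lemma partnerMassFraction_pos {a b : ℝ} (ha : 0 < a) (hb : 0 < b) (k : ℕ) :
    0 < partnerMassFraction a b k := by
  unfold partnerMassFraction
  split_ifs <;> positivity

lemma partnerMassFraction_mul_succ {a b : ℝ} (ha : 0 < a) (hb : 0 < b) (k : ℕ) :
    partnerMassFraction a b k * partnerMassFraction a b (k + 1) = b / ((a + b) * (a + 1)) := by
  unfold partnerMassFraction
  rcases Nat.even_or_odd k with h | h
  · simp only [h, Nat.even_add_one, if_true, not_true, if_false]
    field_simp
    ring
  · simp only [Nat.not_even_iff_odd.2 h, Nat.even_add_one, if_true, not_false_iff, if_false]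
    field_simp
    ring

/-- In collision `k`, particle `1` meets the spectator of collision `k + 1`: their relative velocity is
multiplied by the phasor, and particle `1` takes up the share of the change that the partner's mass
dictates. -/
lemma scatter_collisions232 {a b : ℝ} (ha : 0 < a) (hb : 0 < b) (k : ℕ) (x : ℂ) (V V' : Fin 3 → ℂ)
    (h : V' = scatteringMatrix a b (collisions232 k) x *ᵥ V) :
    V' 0 = V 0 + partnerMassFraction a b k * (x - 1) * (V 0 - V (collisions232 (k + 1))) ∧
    V' (collisions232 k) = V (collisions232 k) ∧
    V' 0 - V' (collisions232 (k + 1)) = x * (V 0 - V (collisions232 (k + 1))) := by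
  have h1 : (a : ℂ) + b ≠ 0 := by exact_mod_cast (add_pos ha hb).ne'
  have h2 : (1 : ℂ) + a ≠ 0 := by exact_mod_cast (add_pos one_pos ha).ne'
  subst h
  rcases Nat.even_or_odd k with hk | hk
  · simp only [collisions232, partnerMassFraction, hk, Nat.even_add_one, if_true, not_true,
      if_false, scatteringMatrix]
    refine ⟨?_, ?_, ?_⟩ <;>
    · simp [Matrix.mulVec, dotProduct, Fin.sum_univ_three, Matrix.smul_apply]
      field_simp
      try ring
  · simp only [collisions232, partnerMassFraction, Nat.not_even_iff_odd.2 hk, Nat.even_add_one,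
      if_true, not_false_iff, if_false, scatteringMatrix]
    refine ⟨?_, ?_, ?_⟩ <;>
    · simp [Matrix.mulVec, dotProduct, Fin.sum_univ_three, Matrix.smul_apply]
      field_simp
      try ring

/-- After collision `k`: the velocity of particle `1` relative to the particle that it has just met. -/
def partnerVelocity (v : ℕ → Fin 3 → ℂ) (k : ℕ) : ℂ := v (k + 1) 0 - v (k + 1) (collisions232 (k + 1))

/-- After collision `k`: the velocity of particle `1` relative to the particle that it meets next. -/
def targetVelocity (v : ℕ → Fin 3 → ℂ) (k : ℕ) : ℂ := v (k + 1) 0 - v (k + 1) (collisions232 k)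

lemma partnerVelocity_succ {a b : ℝ} (ha : 0 < a) (hb : 0 < b) {k : ℕ} {x : ℂ}
    {v : ℕ → Fin 3 → ℂ}
    (h : v (k + 2) = scatteringMatrix a b (collisions232 (k + 1)) x *ᵥ v (k + 1)) :
    partnerVelocity v (k + 1) = x * targetVelocity v k := by
  have := (scatter_collisions232 ha hb (k + 1) x _ _ h).2.2
  rw [collisions232_add_two] at this
  rw [partnerVelocity, collisions232_add_two]
  exact this

lemma targetVelocity_succ {a b : ℝ} (ha : 0 < a) (hb : 0 < b) {k : ℕ} {x : ℂ}
    {v : ℕ → Fin 3 → ℂ}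
    (h : v (k + 2) = scatteringMatrix a b (collisions232 (k + 1)) x *ᵥ v (k + 1)) :
    targetVelocity v (k + 1) = partnerVelocity v k +
      partnerMassFraction a b (k + 1) * (x - 1) * targetVelocity v k := by
  obtain ⟨h1, h2, -⟩ := scatter_collisions232 ha hb (k + 1) x _ _ h
  rw [targetVelocity, h1, h2, collisions232_add_two, partnerVelocity, targetVelocity]
  ring

/-! ### From a capture process to its angle -/

/-- Two phasors whose differences from `1` have the same direction are equal: a ray from `1` meets the
unit circle in at most one more point. -/
lemma phasor_eq_of_real {x y : ℂ} {r : ℝ} (hx : ‖x‖ = 1) (hy : ‖y‖ = 1) (hr : 0 < r)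
    (h : (1 - (starRingEnd ℂ) x) * (1 - y) = r) : y = x ∧ r = 2 - 2 * x.re := by
  have hx2 : x.re * x.re + x.im * x.im = 1 := by
    rw [← Complex.normSq_apply, Complex.normSq_eq_norm_sq, hx, one_pow]
  have hy2 : y.re * y.re + y.im * y.im = 1 := by
    rw [← Complex.normSq_apply, Complex.normSq_eq_norm_sq, hy, one_pow]
  have hre := congrArg Complex.re h
  have him := congrArg Complex.im h
  simp at hre him
  have hx1 : 0 < 1 - x.re := by
    by_contra! h1
    have h2 : x.im = 0 := by nlinarith
    have h3 : x.re = 1 := by nlinarith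
    rw [h2, h3] at hre
    linarith
  have hy1 : 0 < 1 - y.re := by
    by_contra! h1
    have h2 : y.im = 0 := by nlinarith
    have h3 : y.re = 1 := by nlinarith
    rw [h2, h3] at hre
    linarith
  have h1 : x.im * (1 - y.re) = y.im * (1 - x.re) := by linarith
  have h2 : ((1 + y.re) * (1 - x.re) - (1 + x.re) * (1 - y.re)) *
      ((1 - x.re) * (1 - y.re)) = 0 := by
    have := congrArg (· ^ 2) h1
    simp only [mul_pow] at this
    have e1 : x.im ^ 2 = 1 - x.re * x.re := by linarith
    have e2 : y.im ^ 2 = 1 - y.re * y.re := by linarith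
    rw [e1, e2] at this
    linear_combination -this
  have h3 : y.re = x.re := by
    rcases mul_eq_zero.1 h2 with h2 | h2
    · linarith
    · exact absurd h2 (mul_pos hx1 hy1).ne'
  have h4 : y.im = x.im := by
    rw [h3] at h1
    exact (mul_right_cancel₀ hx1.ne' h1).symm
  refine ⟨Complex.ext h3 h4, ?_⟩
  rw [h3, h4] at hre
  linarith

/-- What a capture process says about the relative velocities: from one collision to the next, the
velocity relative to the spectator is multiplied by `-L k`, where `L k` is the quotient of
successive times, and `L (2n - 1) = 0` expresses capture. -/
lemma IsCaptureProcess.exists_ratios {n : ℕ} (hn : 1 ≤ n) {a b : ℝ}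
    {x : ℕ → ℂ} {t : ℕ → ℝ} {r v : ℕ → Fin 3 → ℂ}
    (h : IsCaptureProcess a b (2 * n + 1) collisions232 x t r v) :
    ∃ L : ℕ → ℝ, (∀ k, k + 1 < 2 * n → 0 < L k) ∧ L (2 * n - 1) = 0 ∧
      ∀ k < 2 * n, targetVelocity v (k + 1) = -L k * partnerVelocity v k := by
  have hmeet : ∀ k < 2 * n + 1, r k 0 = r k (collisions232 (k + 1)) := fun k hk =>
    h.meet k hk 0 _ (collisions232_ne_zero k) (collisions232_succ_ne k)
  have hD : ∀ k < 2 * n, r k (collisions232 k) - r k 0 = t k * targetVelocity v k := by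
    intro k hk
    have h1 := hmeet (k + 1) (by omega)
    rw [collisions232_add_two, h.free k (by omega), h.free k (by omega)] at h1
    rw [targetVelocity]
    linear_combination -h1
  have hL : ∀ k, k + 1 < 2 * n →
      t (k + 1) * targetVelocity v (k + 1) = -t k * partnerVelocity v k := by
    intro k hk
    have h1 := hmeet k (by omega)
    rw [← hD (k + 1) hk, h.free k (by omega), h.free k (by omega), ← h1, partnerVelocity]
    ring
  refine ⟨fun k => if k + 1 < 2 * n then t k / t (k + 1) else 0, fun k hk => ?_, ?_, ?_⟩
  · simp only [hk, if_true]
    exact div_pos (h.time_pos k (by omega)) (h.time_pos (k + 1) (by omega))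
  · exact if_neg (by omega)
  · intro k hk
    by_cases hk' : k + 1 < 2 * n
    · simp only [hk', if_true]
      have h0 : (t (k + 1) : ℂ) ≠ 0 := by exact_mod_cast (h.time_pos (k + 1) (by omega)).ne'
      refine mul_left_cancel₀ h0 ?_
      rw [hL k hk']
      push_cast
      field_simp
    · simp only [hk', if_false, Complex.ofReal_zero, neg_zero, zero_mul]
      have hw : collisions232 (2 * n) = 1 := by simp [collisions232]
      rw [show k + 1 = 2 * n by omega, targetVelocity, hw, h.capture, sub_self]

/-- The recurrence for the quotients of successive times, counted from the last collision, has the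
solution `sin (j ψ) / sin ((j + 2) ψ)`; the quotients stay positive only as long as
`(j + 2) ψ < π`. -/
lemma angle_of_recurrence {ψ : ℝ} (h0 : 0 < ψ) (h2 : ψ < Real.pi / 2) (l : ℕ → ℝ) (N : ℕ)
    (hl0 : l 0 = 0) (hl : ∀ j < N, 0 < l (j + 1))
    (hrec : ∀ j < N, (1 + l (j + 1)) * (1 + l j) = 4 * Real.cos ψ ^ 2 * l (j + 1)) :
    ∀ j ≤ N, (j + 2) * ψ < Real.pi ∧ l j * Real.sin ((j + 2) * ψ) = Real.sin (j * ψ) := by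
  have hc : 0 < Real.cos ψ := Real.cos_pos_of_mem_Ioo ⟨by linarith, h2⟩
  intro j
  induction j with
  | zero => intro _; simpa [hl0] using by linarith
  | succ j ih =>
    intro hj
    obtain ⟨h3, h4⟩ := ih (by omega)
    have hj0 : (0 : ℝ) ≤ j := j.cast_nonneg
    push_cast
    have e1 : (j : ℝ) * ψ = (j + 1) * ψ - ψ := by ring
    have e2 : ((j : ℝ) + 2) * ψ = (j + 1) * ψ + ψ := by ring
    have e3 : ((j : ℝ) + 1) * ψ = (j + 2) * ψ - ψ := by ring
    have e4 : ((j : ℝ) + 1 + 2) * ψ = (j + 2) * ψ + ψ := by ring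
    have hs1 : 0 < Real.sin ((j + 1) * ψ) :=
      Real.sin_pos_of_pos_of_lt_pi (by positivity) (by linarith)
    have hs2 : 0 < Real.sin ((j + 2) * ψ) :=
      Real.sin_pos_of_pos_of_lt_pi (by positivity) h3
    have h5 : (1 + l j) * Real.sin ((j + 2) * ψ) =
        2 * Real.cos ψ * Real.sin ((j + 1) * ψ) := by
      rw [add_mul, h4, e1, e2, Real.sin_add, Real.sin_sub]; ring
    have h6 : Real.sin ((j + 1) * ψ) + Real.sin ((j + 1 + 2) * ψ) =
        2 * Real.cos ψ * Real.sin ((j + 2) * ψ) := by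
      rw [e3, e4, Real.sin_add, Real.sin_sub]; ring
    have h7 : l (j + 1) * Real.sin ((j + 1 + 2) * ψ) = Real.sin ((j + 1) * ψ) := by
      have h8 := hrec j (by omega)
      refine mul_left_cancel₀ (mul_pos two_pos hc).ne' ?_
      linear_combination 2 * Real.cos ψ * l (j + 1) * h6 - Real.sin ((j + 2) * ψ) * h8 +
        (1 + l (j + 1)) * h5
    refine ⟨?_, h7⟩
    have h8 : 0 < Real.sin ((j + 1 + 2) * ψ) :=
      pos_of_mul_pos_right (h7 ▸ hs1) (hl j (by omega)).le
    by_contra! h9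
    have := Real.sin_nonneg_of_nonneg_of_le_pi
      (x := (j + 1 + 2) * ψ - Real.pi) (by linarith) (by linarith)
    rw [Real.sin_sub_pi] at this
    linarith

/-- The condition that the phasor of the first collision is a unit number, in terms of the angle `ψ`.
Here `ρ` is `1` plus the first quotient of times, and `s, c, S, C` are the sine and cosine of `ψ` and of
`(2n+1)ψ`. -/
lemma first_phasor_iff {a b s c S C ρ κ : ℝ} (hc : 0 < c) (hS : 0 < S)
    (h1 : s ^ 2 + c ^ 2 = 1) (h2 : S ^ 2 + C ^ 2 = 1) (hκ : κ = 4 * c ^ 2)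
    (hρ : ρ * S = 2 * c * (S * c - C * s)) :
    (ρ ^ 2 - ρ * κ) * (b * (1 + a)) = κ * (a - b) ↔
      S ^ 2 * (a * (1 + b)) = b * (1 + a) * s ^ 2 := by
  have h3 : (ρ ^ 2 - ρ * κ) * S ^ 2 = -4 * c ^ 2 * (S ^ 2 - s ^ 2) := by
    have hC : C ^ 2 = 1 - S ^ 2 := by linarith
    have hc2 : c ^ 2 = 1 - s ^ 2 := by linarith
    have : (ρ ^ 2 - ρ * κ) * S ^ 2 = (ρ * S) ^ 2 - κ * S * (ρ * S) := by ring
    rw [this, hρ, hκ]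
    have : (2 * c * (S * c - C * s)) ^ 2 - 4 * c ^ 2 * S * (2 * c * (S * c - C * s)) =
        -4 * c ^ 2 * (S ^ 2 * c ^ 2 - C ^ 2 * s ^ 2) := by ring
    rw [this, hC, show S ^ 2 * c ^ 2 = S ^ 2 * (1 - s ^ 2) by rw [hc2]]
    ring
  have hS2 : S ^ 2 ≠ 0 := by positivity
  have hc4 : 4 * c ^ 2 ≠ 0 := by positivity
  constructor
  · intro h
    refine mul_left_cancel₀ hc4 ?_
    linear_combination b * (1 + a) * h3 - S ^ 2 * h - S ^ 2 * (a - b) * hκ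
  · intro h
    refine mul_right_cancel₀ hS2 ?_
    linear_combination b * (1 + a) * h3 - 4 * c ^ 2 * h - S ^ 2 * (a - b) * hκ

lemma normSq_sub_mul_one_sub {y : ℂ} (hy : ‖y‖ = 1) (ρ g : ℝ) :
    Complex.normSq (ρ - g * (1 - y)) =
      ρ ^ 2 - ρ * (g * (2 - 2 * y.re)) + g * (g * (2 - 2 * y.re)) := by
  have hy2 : y.re * y.re + y.im * y.im = 1 := by
    rw [← Complex.normSq_apply, Complex.normSq_eq_norm_sq, hy, one_pow]
  rw [Complex.normSq_apply]
  simp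
  linear_combination g ^ 2 * hy2

lemma normSq_one_sub {y : ℂ} (hy : ‖y‖ = 1) : Complex.normSq (1 - y) = 2 - 2 * y.re := by
  have := normSq_sub_mul_one_sub hy 0 1
  simp at this
  rw [← Complex.normSq_neg]
  simpa using this

/-- The number of which the first phasor is a quotient has the right absolute value exactly if the
equation for the angle holds; see `first_phasor_iff`. -/
lemma normSq_eq_iff {a b ρ : ℝ} {y : ℂ} (ha : 0 < a) (hb : 0 < b) (hy : ‖y‖ = 1) :
    Complex.normSq (ρ - (b / ((a + b) * (a + 1)) : ℝ) * (1 - y)) =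
        (a / ((a + b) * (a + 1))) ^ 2 * Complex.normSq (1 - y) ↔
      (ρ ^ 2 - ρ * (b / ((a + b) * (a + 1)) * (2 - 2 * y.re))) * (b * (1 + a)) =
        b / ((a + b) * (a + 1)) * (2 - 2 * y.re) * (a - b) := by
  rw [normSq_sub_mul_one_sub hy, normSq_one_sub hy]
  generalize 2 - 2 * y.re = d
  have h1 : a + b ≠ 0 := by positivity
  have h2 : a + 1 ≠ 0 := by positivity
  constructor
  · intro h
    field_simp at h ⊢
    refine mul_left_cancel₀ h1 ?_
    linear_combination h
  · intro h
    field_simp at h ⊢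
    linear_combination (a + b) * h

/-- The angle of a capture process: all phasors but the first agree, and their common value `y`
determines the angle through `4 cos² ψ = b |1 - y|² / ((a + b) (a + 1))`. -/
lemma IsCaptureProcess.exists_isCaptureAngle {n : ℕ} (hn : 1 ≤ n) {a b : ℝ} (ha : 0 < a)
    (hb : 0 < b) {x : ℕ → ℂ} {t : ℕ → ℝ} {r v : ℕ → Fin 3 → ℂ}
    (h : IsCaptureProcess a b (2 * n + 1) collisions232 x t r v) :
    (∀ k, 1 ≤ k → k < 2 * n + 1 → x k = x 1) ∧ ∃ ψ, IsCaptureAngle n a b ψ ∧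
      4 * Real.cos ψ ^ 2 = b / ((a + b) * (a + 1)) * (2 - 2 * (x 1).re) := by
  obtain ⟨L, hLpos, hLlast, hL⟩ := h.exists_ratios hn
  set A := partnerVelocity v
  set B := targetVelocity v
  set μ := partnerMassFraction a b
  have hμ : ∀ k, 0 < μ k := partnerMassFraction_pos ha hb
  have hLnn : ∀ k < 2 * n, 0 ≤ L k := fun k hk => by
    by_cases hk' : k + 1 < 2 * n
    · exact (hLpos k hk').le
    · rw [show k = 2 * n - 1 by omega, hLlast]
  have hA : ∀ k < 2 * n, A (k + 1) = x (k + 1) * B k := fun k hk =>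
    partnerVelocity_succ ha hb (h.scatter (k + 1) (by omega))
  have hB : ∀ k < 2 * n, (1 + L k) * A k = μ (k + 1) * (1 - x (k + 1)) * B k := fun k hk => by
    have h1 := targetVelocity_succ ha hb (h.scatter (k + 1) (by omega))
    have h2 := hL k hk
    linear_combination h2 - h1
  -- the first collision
  obtain ⟨h01, h02, h03⟩ := scatter_collisions232 ha hb 0 _ _ _ (h.scatter 0 (by omega))
  have hw0 : collisions232 0 = 1 := rfl
  have hw1 : collisions232 1 = 2 := rfl
  simp only [zero_add, hw0, hw1, h.initial_velocity_two, h.initial_velocity_three, sub_zero]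
    at h01 h02 h03
  have hA0 : A 0 = x 0 * v 0 0 := h03
  have hB0 : B 0 = (1 + μ 0 * (x 0 - 1)) * v 0 0 := by
    change v 1 0 - v 1 1 = _
    rw [h01, h02]; ring
  have hx0 : ∀ k < 2 * n + 1, x k ≠ 0 := fun k hk => by
    rw [← norm_ne_zero_iff, h.phasor k hk]; exact one_ne_zero
  have hone : ∀ k < 2 * n, (1 + L k : ℂ) ≠ 0 := fun k hk => by
    have := hLnn k hk
    exact_mod_cast (by linarith : 0 < 1 + L k).ne'
  have hAB : ∀ k < 2 * n, A k ≠ 0 ∧ B k ≠ 0 := by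
    have hAtoB : ∀ k < 2 * n, A k ≠ 0 → B k ≠ 0 := fun k hk h1 h2 => by
      have := hB k hk
      rw [h2, mul_zero] at this
      exact (mul_ne_zero (hone k hk) h1) this
    intro k
    induction k with
    | zero =>
      intro hk
      have h1 : A 0 ≠ 0 := by
        rw [hA0]; exact mul_ne_zero (hx0 0 (by omega)) h.initial_velocity_one
      exact ⟨h1, hAtoB 0 hk h1⟩
    | succ k ih =>
      intro hk
      have h1 : A (k + 1) ≠ 0 := by
        rw [hA k (by omega)]; exact mul_ne_zero (hx0 _ (by omega)) (ih (by omega)).2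
      exact ⟨h1, hAtoB _ hk h1⟩
  set g := b / ((a + b) * (a + 1)) with hg
  have hg0 : 0 < g := by positivity
  -- two successive collisions
  have hpair : ∀ k, k + 1 < 2 * n → x (k + 2) = x (k + 1) ∧
      (1 + L k) * (1 + L (k + 1)) = g * (2 - 2 * (x (k + 1)).re) * L k := by
    intro k hk
    have h1 := hB (k + 1) hk
    have h2 := hB k (by omega)
    rw [hA k (by omega), hL k (by omega)] at h1
    have hgk : (μ (k + 1) : ℂ) * μ (k + 2) = g := by
      exact_mod_cast partnerMassFraction_mul_succ ha hb (k + 1)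
    have hconj : (starRingEnd ℂ) (x (k + 1)) * x (k + 1) = 1 := by
      rw [mul_comm, Complex.mul_conj, Complex.normSq_eq_norm_sq, h.phasor _ (by omega)]
      simp
    have h3 : (1 + L k : ℂ) * (1 + L (k + 1)) =
        L k * g * ((1 - (starRingEnd ℂ) (x (k + 1))) * (1 - x (k + 2))) := by
      refine mul_right_cancel₀ (hAB k (by omega)).2 ?_
      rw [← hgk]
      have e1 : (1 + L k : ℂ) * (1 + L (k + 1)) * B k = (starRingEnd ℂ) (x (k + 1)) *
          ((1 + L k) * ((1 + L (k + 1)) * (x (k + 1) * B k))) := by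
        linear_combination -(1 + L k : ℂ) * (1 + L (k + 1)) * B k * hconj
      have e2 : (1 + L k : ℂ) * ((1 + L (k + 1)) * (x (k + 1) * B k)) =
          μ (k + 2) * (1 - x (k + 2)) * -L k * (μ (k + 1) * (1 - x (k + 1)) * B k) := by
        linear_combination (1 + L k : ℂ) * h1 - μ (k + 2) * (1 - x (k + 2)) * L k * h2
      rw [e1, e2]
      linear_combination μ (k + 2) * (1 - x (k + 2)) * L k * μ (k + 1) * B k * hconj
    have hLk := hLpos k hk
    have hLk1 := hLnn (k + 1) hk
    have h4 : (1 - (starRingEnd ℂ) (x (k + 1))) * (1 - x (k + 2)) =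
        (((1 + L k) * (1 + L (k + 1)) / (L k * g) : ℝ) : ℂ) := by
      have hne : ((L k * g : ℝ) : ℂ) ≠ 0 := by exact_mod_cast (mul_pos hLk hg0).ne'
      rw [Complex.ofReal_div, eq_div_iff hne]
      push_cast
      rw [h3]; ring
    obtain ⟨h5, h6⟩ := phasor_eq_of_real (h.phasor _ (by omega)) (h.phasor _ (by omega))
      (by positivity) h4
    refine ⟨h5, ?_⟩
    rw [← h6]
    field_simp
  have hx : ∀ k, 1 ≤ k → k < 2 * n + 1 → x k = x 1 := by
    intro k hk
    induction k, hk using Nat.le_induction with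
    | base => intro _; rfl
    | succ k hk ih =>
      intro hk'
      obtain ⟨j, rfl⟩ := Nat.exists_eq_add_of_le' hk
      rw [(hpair j (by omega)).1]
      exact ih (by omega)
  refine ⟨hx, ?_⟩
  have hy := h.phasor 1 (by omega)
  have hre : -1 ≤ (x 1).re := by
    have := Complex.abs_re_le_norm (x 1)
    rw [hy] at this
    exact (abs_le.1 this).1
  set κ := g * (2 - 2 * (x 1).re) with hκ
  have hrec : ∀ k, k + 1 < 2 * n → (1 + L k) * (1 + L (k + 1)) = κ * L k := fun k hk => by
    rw [(hpair k hk).2, hx (k + 1) (by omega) (by omega)]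
  have hκ0 : 0 < κ := by
    have h1 := hLpos 0 (by omega)
    have h2 := hLnn 1 (by omega)
    have h3 := hrec 0 (by omega)
    have h4 : 0 < κ * L 0 := h3 ▸ by positivity
    exact pos_of_mul_pos_left h4 h1.le
  have hκg : κ ≤ 4 * g := by rw [hκ]; nlinarith
  have hg1 : g < 1 := by
    rw [hg, div_lt_one (by positivity)]
    nlinarith [mul_pos ha hb, mul_pos ha ha]
  -- the angle
  obtain ⟨ψ, hψ0, hψ2, hψ⟩ : ∃ ψ, 0 < ψ ∧ ψ < Real.pi / 2 ∧ 4 * Real.cos ψ ^ 2 = κ := by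
    have h1 : 0 < Real.sqrt (κ / 4) := Real.sqrt_pos.2 (by linarith)
    have h2 : Real.sqrt (κ / 4) < 1 := by
      rw [Real.sqrt_lt' one_pos]; linarith
    refine ⟨Real.arccos (Real.sqrt (κ / 4)), Real.arccos_pos.2 h2,
      Real.arccos_lt_pi_div_two.2 h1, ?_⟩
    rw [Real.cos_arccos (by linarith) h2.le, Real.sq_sqrt (by linarith)]
    ring
  have hc : 0 < Real.cos ψ := Real.cos_pos_of_mem_Ioo ⟨by linarith, hψ2⟩
  obtain ⟨h1, h2⟩ := angle_of_recurrence hψ0 hψ2 (fun j => L (2 * n - 1 - j)) (2 * n - 1) hLlast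
    (fun j hj => hLpos _ (by omega)) (fun j hj => by
      have := hrec (2 * n - 1 - (j + 1)) (by omega)
      rw [show 2 * n - 1 - (j + 1) + 1 = 2 * n - 1 - j by omega] at this
      rw [hψ, this]) (2 * n - 1) le_rfl
  have hcast : ((2 * n - 1 : ℕ) : ℝ) = 2 * n - 1 := by
    rw [Nat.cast_sub (by omega)]; push_cast; ring
  rw [hcast, show (2 * (n : ℝ) - 1 + 2) * ψ = (2 * n + 1) * ψ by ring] at h1 h2
  rw [Nat.sub_self] at h2
  have hS : 0 < Real.sin ((2 * n + 1) * ψ) := Real.sin_pos_of_pos_of_lt_pi (by positivity) h1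
  have hρ : (1 + L 0) * Real.sin ((2 * n + 1) * ψ) = 2 * Real.cos ψ *
      (Real.sin ((2 * n + 1) * ψ) * Real.cos ψ - Real.cos ((2 * n + 1) * ψ) * Real.sin ψ) := by
    rw [add_mul, h2, show (2 * (n : ℝ) - 1) * ψ = (2 * n + 1) * ψ - 2 * ψ by ring,
      Real.sin_sub, Real.cos_two_mul, Real.sin_two_mul]
    ring
  refine ⟨ψ, ⟨hψ0, h1, ?_, ?_⟩, hψ⟩
  · refine (first_phasor_iff hc hS (Real.sin_sq_add_cos_sq _) (Real.sin_sq_add_cos_sq _)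
      hψ.symm hρ).1 ?_
    refine (normSq_eq_iff ha hb hy).1 ?_
    have h5 := hB 0 (by omega)
    have hμ0 : μ 0 = b / (a + b) := partnerMassFraction_zero a b
    have hμ1 : μ 1 = 1 / (1 + a) := partnerMassFraction_one a b
    rw [hA0, hB0, zero_add, hμ0, hμ1] at h5
    have h6 : (((1 + L 0 : ℝ) : ℂ) - (g : ℝ) * (1 - x 1)) * x 0 =
        ((a / ((a + b) * (a + 1)) : ℝ) : ℂ) * (1 - x 1) := by
      refine mul_right_cancel₀ h.initial_velocity_one ?_
      have e1 : (a : ℂ) + b ≠ 0 := by exact_mod_cast (add_pos ha hb).ne'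
      have e2 : (1 : ℂ) + a ≠ 0 := by exact_mod_cast (add_pos one_pos ha).ne'
      have e3 : (a : ℂ) + 1 ≠ 0 := by rwa [add_comm]
      rw [hg]
      push_cast at h5 ⊢
      field_simp at h5 ⊢
      linear_combination h5
    have h7 := congrArg Complex.normSq h6
    have hx0n : Complex.normSq (x 0) = 1 := by
      rw [Complex.normSq_eq_norm_sq, h.phasor 0 (by omega), one_pow]
    rw [Complex.normSq_mul, Complex.normSq_mul, hx0n, mul_one, Complex.normSq_ofReal,
      ← pow_two] at h7
    exact h7
  · have h8 : Real.cos ψ ^ 2 ≤ g := by linarith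
    rwa [hg, le_div_iff₀ (by positivity)] at h8

/-! ### From an angle to a capture process -/

/-- The velocities that result from the initial velocities `1, 0, 0` with given phasors. -/
noncomputable def captureVelocity (a b : ℝ) (x : ℕ → ℂ) : ℕ → Fin 3 → ℂ
  | 0 => ![1, 0, 0]
  | k + 1 => scatteringMatrix a b (collisions232 k) (x k) *ᵥ captureVelocity a b x k

/-- The positions that result from the velocities `v` and the times `t`, if particles `1` and `3` first
meet at the origin and particle `2` waits where particle `1` arrives after the time `t 0`. -/
noncomputable def capturePosition (t : ℕ → ℝ) (v : ℕ → Fin 3 → ℂ) : ℕ → Fin 3 → ℂ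
  | 0 => ![0, t 0 * targetVelocity v 0, 0]
  | k + 1 => fun i => capturePosition t v k i + t k * v (k + 1) i

/-- A motion is a capture process as soon as the relative velocities are related by quotients `L k` of
the successive times with `L (2n - 1) = 0`. -/
lemma isCaptureProcess_of_ratios {n : ℕ} (hn : 1 ≤ n) {a b : ℝ} {x : ℕ → ℂ} {t L : ℕ → ℝ}
    (hx : ∀ k, ‖x k‖ = 1) (ht : ∀ k < 2 * n, 0 < t k)
    (htL : ∀ k, k + 1 < 2 * n → t k = L k * t (k + 1)) (hL : L (2 * n - 1) = 0)
    (hB0 : targetVelocity (captureVelocity a b x) 0 ≠ 0)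
    (hB : ∀ k < 2 * n, targetVelocity (captureVelocity a b x) (k + 1) =
      -L k * partnerVelocity (captureVelocity a b x) k) :
    IsCaptureProcess a b (2 * n + 1) collisions232 x t
      (capturePosition t (captureVelocity a b x)) (captureVelocity a b x) := by
  set v := captureVelocity a b x
  set r := capturePosition t v
  have hfree : ∀ k i, r (k + 1) i = r k i + t k * v (k + 1) i := fun k i => rfl
  have hmeet : ∀ k < 2 * n + 1, r k 0 = r k (collisions232 (k + 1)) ∧
      (k < 2 * n → r k (collisions232 k) - r k 0 = t k * targetVelocity v k) := by
    intro k
    induction k with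
    | zero =>
      intro _
      refine ⟨rfl, fun _ => ?_⟩
      change (t 0 : ℂ) * targetVelocity v 0 - 0 = _
      rw [sub_zero]
    | succ k ih =>
      intro hk
      obtain ⟨h1, h2⟩ := ih (by omega)
      have h2 := h2 (by omega)
      rw [targetVelocity] at h2
      refine ⟨?_, fun hk' => ?_⟩
      · rw [collisions232_add_two, hfree, hfree]
        linear_combination -h2
      · rw [hB k (by omega), hfree, hfree, ← h1, htL k hk', partnerVelocity]
        push_cast
        ring
  refine ⟨?_, rfl, rfl, ?_, fun k _ => hx k, ?_, fun k _ => rfl, fun k hk => ht k (by omega),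
    fun k _ i => hfree k i, ?_⟩
  · exact one_ne_zero
  · change (t 0 : ℂ) * targetVelocity v 0 ≠ 0
    refine mul_ne_zero ?_ hB0
    exact_mod_cast (ht 0 (by omega)).ne'
  · intro k hk i j hi hj
    have h1 : ∀ i, i ≠ collisions232 k → r k i = r k 0 := by
      intro i hi
      have h2 : i = 0 ∨ i = collisions232 (k + 1) := by
        have h3 := collisions232_ne_zero k
        have h4 := collisions232_ne_zero (k + 1)
        have h5 := collisions232_succ_ne k
        omega
      rcases h2 with rfl | rfl
      · rfl
      · exact (hmeet k hk).1.symm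
    rw [h1 i hi, h1 j hj]
  · have h1 := hB (2 * n - 1) (by omega)
    rw [show 2 * n - 1 + 1 = 2 * n by omega, hL, targetVelocity,
      show collisions232 (2 * n) = 1 by simp [collisions232]] at h1
    simp only [Complex.ofReal_zero, neg_zero, zero_mul] at h1
    exact sub_eq_zero.1 h1

/-- Every angle belongs to a process: the bound provides the phasor `y`, the recurrence the times, and
the equation for the angle the phasor of the first collision. -/
lemma IsCaptureAngle.classicallyAllowed {n : ℕ} (hn : 1 ≤ n) {a b ψ : ℝ} (ha : 0 < a)
    (hb : 0 < b) (h : IsCaptureAngle n a b ψ) :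
    ClassicallyAllowed a b (2 * n + 1) collisions232 := by
  obtain ⟨hψ0, hlt, heq, hbd⟩ := h
  have hn' : (1 : ℝ) ≤ n := by exact_mod_cast hn
  have h3 : 3 * ψ ≤ (2 * n + 1) * ψ := mul_le_mul_of_nonneg_right (by linarith) hψ0.le
  have hc : 0 < Real.cos ψ := Real.cos_pos_of_mem_Ioo ⟨by linarith, by linarith⟩
  set g := b / ((a + b) * (a + 1)) with hg
  have hg0 : 0 < g := by positivity
  have hcg : Real.cos ψ ^ 2 ≤ g := by rwa [hg, le_div_iff₀ (by positivity)]
  -- the common phasor `y`, found from `4 cos² ψ = g |1 - y|²`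
  obtain ⟨y, hy, hκ⟩ : ∃ y : ℂ, ‖y‖ = 1 ∧ g * (2 - 2 * y.re) = 4 * Real.cos ψ ^ 2 := by
    have h1 : Real.cos ψ ^ 2 / g ≤ 1 := (div_le_one hg0).2 hcg
    have h2 : 0 ≤ Real.cos ψ ^ 2 / g := by positivity
    set d := Real.cos ψ ^ 2 / g with hd
    refine ⟨⟨1 - 2 * d, Real.sqrt (1 - (1 - 2 * d) ^ 2)⟩, ?_, ?_⟩
    · have h4 : 0 ≤ 1 - (1 - 2 * d) ^ 2 := by nlinarith
      rw [← pow_left_inj₀ (norm_nonneg _) zero_le_one two_ne_zero, ← Complex.normSq_eq_norm_sq,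
        Complex.normSq_apply, ← pow_two, ← pow_two, Real.sq_sqrt h4]
      ring
    · rw [hd]; field_simp; ring
  -- the quotients of times
  have hS : ∀ k : ℝ, 0 ≤ k → k < 2 * n + 1 → 0 < Real.sin ((2 * n + 1 - k) * ψ) :=
    fun k hk hk' => Real.sin_pos_of_pos_of_lt_pi (mul_pos (by linarith) hψ0)
      (lt_of_le_of_lt (mul_le_mul_of_nonneg_right (by linarith) hψ0.le) hlt)
  have hS0 : ∀ k : ℕ, k < 2 * n → 0 < Real.sin ((2 * n + 1 - k) * ψ) := fun k hk =>
    hS k k.cast_nonneg (by exact_mod_cast (by omega : k < 2 * n + 1))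
  have hS1 : ∀ k : ℕ, k < 2 * n → 0 < Real.sin ((2 * n - k) * ψ) := fun k hk => by
    have := hS (k + 1) (by positivity) (by exact_mod_cast (by omega : k + 1 < 2 * n + 1))
    rwa [show 2 * (n : ℝ) + 1 - (k + 1) = 2 * n - k by ring] at this
  have hS2 : ∀ k : ℕ, k + 1 < 2 * n → 0 < Real.sin ((2 * n - 1 - k) * ψ) := fun k hk => by
    have := hS (k + 2) (by positivity) (by exact_mod_cast (by omega : k + 2 < 2 * n + 1))
    rwa [show 2 * (n : ℝ) + 1 - (k + 2) = 2 * n - 1 - k by ring] at this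
  obtain ⟨L, hLdef⟩ : ∃ L : ℕ → ℝ, ∀ k, L k =
      Real.sin ((2 * n - 1 - k) * ψ) / Real.sin ((2 * n + 1 - k) * ψ) := ⟨_, fun k => rfl⟩
  obtain ⟨t, htdef⟩ : ∃ t : ℕ → ℝ, ∀ k, t k =
      1 / (Real.sin ((2 * n - k) * ψ) * Real.sin ((2 * n + 1 - k) * ψ)) := ⟨_, fun k => rfl⟩
  have hcast1 : ∀ k : ℕ, (2 * (n : ℝ) + 1 - (k + 1 : ℕ)) * ψ = (2 * n - k) * ψ := fun k => by
    push_cast; ring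
  have hcast2 : ∀ k : ℕ, (2 * (n : ℝ) - (k + 1 : ℕ)) * ψ = (2 * n - 1 - k) * ψ := fun k => by
    push_cast; ring
  have hρ : ∀ k : ℕ, k < 2 * n → (1 + L k) * Real.sin ((2 * n + 1 - k) * ψ) =
      2 * Real.cos ψ * Real.sin ((2 * n - k) * ψ) := fun k hk => by
    have h1 := (hS0 k hk).ne'
    rw [hLdef, add_mul, div_mul_cancel₀ _ h1,
      show (2 * (n : ℝ) + 1 - k) * ψ = (2 * n - k) * ψ + ψ by ring,
      show (2 * (n : ℝ) - 1 - k) * ψ = (2 * n - k) * ψ - ψ by ring, Real.sin_add, Real.sin_sub]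
    ring
  have hrec : ∀ k : ℕ, k + 1 < 2 * n →
      (1 + L k) * (1 + L (k + 1)) = 4 * Real.cos ψ ^ 2 * L k := fun k hk => by
    have h1 := hS0 k (by omega)
    have h2 := hS1 k (by omega)
    have h4 := hρ (k + 1) (by omega)
    rw [hcast1, hcast2] at h4
    have h5 := hρ k (by omega)
    have h6 : L k * Real.sin ((2 * n + 1 - k) * ψ) = Real.sin ((2 * n - 1 - k) * ψ) := by
      rw [hLdef, div_mul_cancel₀ _ h1.ne']
    refine mul_right_cancel₀ (mul_pos h1 h2).ne' ?_
    linear_combination (1 + L k) * Real.sin ((2 * n + 1 - k) * ψ) * h4 +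
      2 * Real.cos ψ * Real.sin ((2 * n - 1 - k) * ψ) * h5 -
      4 * Real.cos ψ ^ 2 * Real.sin ((2 * n - k) * ψ) * h6
  -- the first phasor
  have hSM : 0 < Real.sin ((2 * n + 1) * ψ) := Real.sin_pos_of_pos_of_lt_pi (by positivity) hlt
  have hρ0 : (1 + L 0) * Real.sin ((2 * n + 1) * ψ) = 2 * Real.cos ψ *
      (Real.sin ((2 * n + 1) * ψ) * Real.cos ψ - Real.cos ((2 * n + 1) * ψ) * Real.sin ψ) := by
    have := hρ 0 (by omega)
    rw [Nat.cast_zero, sub_zero, sub_zero] at this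
    rw [this, show 2 * (n : ℝ) * ψ = (2 * n + 1) * ψ - ψ by ring, Real.sin_sub]
  have hnorm := (normSq_eq_iff (ρ := 1 + L 0) ha hb hy).2 (by
    rw [← hg, hκ]
    exact (first_phasor_iff hc hSM (Real.sin_sq_add_cos_sq _) (Real.sin_sq_add_cos_sq _) rfl
      hρ0).2 heq)
  rw [← hg] at hnorm
  have hy1 : 1 - y ≠ 0 := fun h0 => by
    have h1 : y = 1 := (sub_eq_zero.1 h0).symm
    rw [h1] at hκ
    simp at hκ
    exact hc.ne' hκ
  set f := a / ((a + b) * (a + 1)) with hf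
  have hf0 : 0 < f := by positivity
  have hfy : (f : ℂ) * (1 - y) ≠ 0 := mul_ne_zero (by exact_mod_cast hf0.ne') hy1
  have hnorm' : ‖((1 + L 0 : ℝ) : ℂ) - (g : ℝ) * (1 - y)‖ = ‖(f : ℂ) * (1 - y)‖ := by
    rw [← pow_left_inj₀ (norm_nonneg _) (norm_nonneg _) two_ne_zero,
      ← Complex.normSq_eq_norm_sq, ← Complex.normSq_eq_norm_sq, hnorm, Complex.normSq_mul,
      Complex.normSq_ofReal, pow_two]
  have hden : ((1 + L 0 : ℝ) : ℂ) - (g : ℝ) * (1 - y) ≠ 0 := by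
    rw [← norm_ne_zero_iff, hnorm']
    exact norm_ne_zero_iff.2 hfy
  obtain ⟨x₀, hx₀, hx₀n⟩ : ∃ x₀ : ℂ, (((1 + L 0 : ℝ) : ℂ) - (g : ℝ) * (1 - y)) * x₀ =
      f * (1 - y) ∧ ‖x₀‖ = 1 := by
    refine ⟨_, mul_div_cancel₀ _ hden, ?_⟩
    rw [norm_div, hnorm', div_self (norm_ne_zero_iff.2 hfy)]
  let x : ℕ → ℂ := fun k => if k = 0 then x₀ else y
  have hxs : ∀ k, x (k + 1) = y := fun k => if_neg (Nat.succ_ne_zero k)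
  set v := captureVelocity a b x with hv
  set μ := partnerMassFraction a b
  have hμ : ∀ k, (μ k : ℂ) ≠ 0 := fun k => by
    exact_mod_cast (partnerMassFraction_pos ha hb k).ne'
  have hA : ∀ k, partnerVelocity v (k + 1) = y * targetVelocity v k := fun k => by
    rw [← hxs k]
    exact partnerVelocity_succ ha hb rfl
  have hB : ∀ k, targetVelocity v (k + 1) =
      partnerVelocity v k + μ (k + 1) * (y - 1) * targetVelocity v k := fun k => by
    rw [← hxs k]
    exact targetVelocity_succ ha hb rfl
  obtain ⟨h01, h02, h03⟩ := scatter_collisions232 ha hb 0 (x 0) (v 0) (v 1) rfl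
  have hA0 : partnerVelocity v 0 = x₀ := by
    have h1 : v 0 0 - v 0 (collisions232 1) = 1 := sub_zero _
    rw [zero_add, h1, mul_one] at h03
    exact h03
  have hB0 : targetVelocity v 0 = 1 + μ 0 * (x₀ - 1) := by
    have h1 : v 0 0 - v 0 (collisions232 1) = 1 := sub_zero _
    have h2 : v 0 (collisions232 0) = 0 := rfl
    have h4 : v 0 0 = 1 := rfl
    rw [zero_add, h1, mul_one, h4] at h01
    rw [targetVelocity, zero_add, h01, h02, h2, sub_zero]
    rfl
  have hlink : ∀ k < 2 * n, (1 + L k) * partnerVelocity v k =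
      μ (k + 1) * (1 - y) * targetVelocity v k := by
    intro k
    induction k with
    | zero =>
      intro _
      have hμ0 : μ 0 = b / (a + b) := partnerMassFraction_zero a b
      have hμ1 : μ 1 = 1 / (1 + a) := partnerMassFraction_one a b
      rw [hA0, hB0, zero_add, hμ0, hμ1]
      have e1 : (a : ℂ) + b ≠ 0 := by exact_mod_cast (add_pos ha hb).ne'
      have e2 : (1 : ℂ) + a ≠ 0 := by exact_mod_cast (add_pos one_pos ha).ne'
      have e3 : (a : ℂ) + 1 ≠ 0 := by rwa [add_comm]
      rw [hg, hf] at hx₀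
      push_cast at hx₀ ⊢
      field_simp at hx₀ ⊢
      linear_combination hx₀
    | succ k ih =>
      intro hk
      have h1 := ih (by omega)
      have hy2 : (2 - 2 * y.re : ℂ) * y = -(1 - y) ^ 2 := by
        have h4 : (starRingEnd ℂ) y * y = 1 := by
          rw [mul_comm, Complex.mul_conj, Complex.normSq_eq_norm_sq, hy]
          simp
        have h5 := Complex.add_conj y
        push_cast at h5
        linear_combination y * h5 - h4
      have hgk : (μ (k + 1) : ℂ) * μ (k + 2) = g := by
        exact_mod_cast partnerMassFraction_mul_succ ha hb (k + 1)
      have hκ' : (g * (2 - 2 * y.re) : ℂ) = 4 * (Real.cos ψ : ℂ) ^ 2 := by exact_mod_cast hκ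
      have hrec' : (1 + L k : ℂ) * (1 + L (k + 1)) = 4 * (Real.cos ψ : ℂ) ^ 2 * L k := by
        exact_mod_cast hrec k hk
      refine mul_left_cancel₀ (mul_ne_zero (hμ (k + 1)) hy1) ?_
      rw [hA, hB]
      linear_combination (-(1 + L (k + 1)) * y - μ (k + 2) * μ (k + 1) * (1 - y) ^ 2) * h1 +
        y * partnerVelocity v k * hrec' - y * L k * partnerVelocity v k * hκ' +
        g * L k * partnerVelocity v k * hy2 +
        (1 - y) ^ 2 * L k * partnerVelocity v k * hgk
  refine ⟨x, t, _, v, isCaptureProcess_of_ratios hn (L := L) ?_ ?_ ?_ ?_ ?_ ?_⟩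
  · intro k
    by_cases hk : k = 0
    · simpa [x, hk] using hx₀n
    · simpa [x, hk] using hy
  · intro k hk
    rw [htdef]
    exact one_div_pos.2 (mul_pos (hS1 k hk) (hS0 k hk))
  · intro k hk
    have h1 := (hS0 k (by omega)).ne'
    have h2 := (hS1 k (by omega)).ne'
    have h4 := (hS2 k hk).ne'
    rw [htdef, htdef, hLdef, hcast1, hcast2, div_mul_div_comm, mul_one,
      div_eq_div_iff (mul_ne_zero h2 h1) (mul_ne_zero h1 (mul_ne_zero h4 h2))]
    ring
  · rw [hLdef, Nat.cast_sub (by omega)]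
    push_cast
    rw [sub_self, zero_mul, Real.sin_zero, zero_div]
  · intro h0
    have h1 := hlink 0 (by omega)
    rw [← hv] at h0
    rw [h0, mul_zero, hA0] at h1
    have h2 : (1 + L 0 : ℂ) ≠ 0 := by
      have : 0 < (1 + L 0) * Real.sin ((2 * n + 1) * ψ) := by
        have h5 := hρ 0 (by omega)
        rw [Nat.cast_zero, sub_zero, sub_zero] at h5
        rw [h5]
        have h6 := hS1 0 (by omega)
        rw [Nat.cast_zero, sub_zero] at h6
        positivity
      exact_mod_cast (pos_of_mul_pos_left this hSM.le).ne'
    refine mul_ne_zero h2 ?_ h1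
    rw [← norm_ne_zero_iff, hx₀n]
    exact one_ne_zero
  · intro k hk
    rw [← hv, hB]
    linear_combination hlink k hk

/-! ### Algebraic equations of the boundary curves -/

/-- The angle `ψ` is determined by `tan² ψ = a (1 + a + b) / b`. -/
lemma angle_unique_of_tan_sq {p q x y : ℝ} (hp : 0 < p) (hq : 0 < q) (hx0 : 0 < x)
    (hx : x < Real.pi / 2) (hy0 : 0 < y) (hy : y < Real.pi / 2)
    (h1 : p * Real.sin x ^ 2 = q * Real.cos x ^ 2)
    (h2 : p * Real.sin y ^ 2 = q * Real.cos y ^ 2) : x = y := by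
  have hsx : 0 < Real.sin x := Real.sin_pos_of_pos_of_lt_pi hx0 (by linarith)
  have hsy : 0 < Real.sin y := Real.sin_pos_of_pos_of_lt_pi hy0 (by linarith)
  rw [Real.cos_sq'] at h1 h2
  have h3 : Real.sin x ^ 2 = Real.sin y ^ 2 :=
    mul_left_cancel₀ (add_pos hp hq).ne' (by linarith)
  exact Real.injOn_sin ⟨by linarith, hx.le⟩ ⟨by linarith, hy.le⟩
    ((pow_left_inj₀ hsx.le hsy.le two_ne_zero).1 h3)

lemma mem_curveEven_iff_of_angle {n : ℕ} (hn : 1 ≤ n) {a b ψ : ℝ} (ha : 0 < a) (hb : 0 < b)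
    (hψ0 : 0 < ψ) (hψ : ψ < Real.pi / 2)
    (h : b * Real.sin ψ ^ 2 = a * (1 + a + b) * Real.cos ψ ^ 2) :
    (a, b) ∈ curveEven n ↔ 2 * n * ψ < Real.pi ∧
      Real.sin ψ * Real.cos (2 * n * ψ) = a * (Real.cos ψ * Real.sin (2 * n * ψ)) := by
  have hn' : (1 : ℝ) ≤ n := by exact_mod_cast hn
  rw [mem_curveEven_iff hn]
  constructor
  · rintro ⟨-, -, x, hx0, hx, h1, h2⟩
    have h3 : 2 * x ≤ 2 * n * x := mul_le_mul_of_nonneg_right (by linarith) hx0.le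
    obtain rfl : x = ψ := angle_unique_of_tan_sq hb
      (by positivity : 0 < a * (1 + a + b)) hx0 (by linarith) hψ0 hψ (by linarith) h
    exact ⟨hx, h1⟩
  · rintro ⟨h1, h2⟩
    exact ⟨ha, hb, ψ, hψ0, h1, h2, by linarith⟩

lemma mem_curveOdd_iff_of_angle {n : ℕ} {a b ψ : ℝ} (ha : 0 < a) (hb : 0 < b)
    (hψ0 : 0 < ψ) (hψ : ψ < Real.pi / 2)
    (h : b * Real.sin ψ ^ 2 = a * (1 + a + b) * Real.cos ψ ^ 2) :
    (a, b) ∈ curveOdd n ↔ (2 * n + 2) * ψ < Real.pi ∧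
      Real.sin ψ * Real.cos ((2 * n + 2) * ψ) =
        -a * (Real.cos ψ * Real.sin ((2 * n + 2) * ψ)) := by
  have hn' : (0 : ℝ) ≤ n := n.cast_nonneg
  rw [mem_curveOdd_iff]
  constructor
  · rintro ⟨-, -, x, hx0, hx, h1, h2⟩
    have h3 : 2 * x ≤ (2 * n + 2) * x := mul_le_mul_of_nonneg_right (by linarith) hx0.le
    obtain rfl : x = ψ := angle_unique_of_tan_sq hb
      (by positivity : 0 < a * (1 + a + b)) hx0 (by linarith) hψ0 hψ (by linarith) h
    exact ⟨hx, h1⟩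
  · rintro ⟨h1, h2⟩
    exact ⟨ha, hb, ψ, hψ0, h1, h2, by linarith⟩

/-- The angle `ψ = (π - θ) / 2` of the phasor of argument `θ / 2`. -/
lemma exists_angle_thetaPhasor {a b : ℝ} (ha : 0 < a) (hb : 0 < b) :
    ∃ ψ, 2 * Complex.arg (thetaPhasor a b) = Real.pi - 2 * ψ ∧ 0 < ψ ∧ ψ < Real.pi / 2 ∧
      0 < ‖thetaPhasor a b‖ ∧
      ‖thetaPhasor a b‖ * Real.sin ψ = Real.sqrt a * Real.sqrt (1 + a + b) ∧
      ‖thetaPhasor a b‖ * Real.cos ψ = Real.sqrt b := by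
  have hre : (thetaPhasor a b).re = Real.sqrt a * Real.sqrt (1 + a + b) := by
    simp [thetaPhasor, Real.sqrt_mul ha.le]
  have him : (thetaPhasor a b).im = Real.sqrt b := by simp [thetaPhasor]
  have hre0 : 0 < (thetaPhasor a b).re := by rw [hre]; positivity
  have him0 : 0 < (thetaPhasor a b).im := by rw [him]; positivity
  have hz : thetaPhasor a b ≠ 0 := fun h => by simp [h] at hre0
  have h1 := Complex.abs_arg_lt_pi_div_two_iff.2 (Or.inl hre0)
  have hsin := Complex.norm_mul_sin_arg (thetaPhasor a b)
  have h2 : 0 < Complex.arg (thetaPhasor a b) := by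
    refine lt_of_le_of_ne (Complex.arg_nonneg_iff.2 him0.le) fun h0 => ?_
    rw [← h0, Real.sin_zero, mul_zero] at hsin
    exact him0.ne hsin
  refine ⟨Real.pi / 2 - Complex.arg (thetaPhasor a b), by ring, by linarith [(abs_lt.1 h1).2],
    by linarith, norm_pos_iff.2 hz, ?_, ?_⟩
  · rw [Real.sin_pi_div_two_sub, ← hre, Complex.norm_mul_cos_arg]
  · rw [Real.cos_pi_div_two_sub, ← him, hsin]

/-- Both sides have absolute value `1`, and they agree exactly if `z ^ M * s` is real. -/
lemma div_conj_pow_eq_iff {z s : ℂ} (hz : z ≠ 0) (hs : s ≠ 0) (M : ℕ) :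
    (z / (starRingEnd ℂ) z) ^ M = (starRingEnd ℂ) s / s ↔ (z ^ M * s).im = 0 := by
  have hz' : (starRingEnd ℂ) z ≠ 0 := (map_ne_zero _).2 hz
  rw [div_pow, div_eq_div_iff (pow_ne_zero _ hz') hs, ← Complex.conj_eq_iff_im, map_mul, map_pow,
    mul_comm ((starRingEnd ℂ) s), eq_comm]

lemma thetaPhasor_pow_im {n : ℕ} {z s : ℂ} {ψ : ℝ} (h : 2 * Complex.arg z = Real.pi - 2 * ψ) :
    (z ^ (2 * n + 1) * s).im = ‖z‖ ^ (2 * n + 1) * (-1) ^ n *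
      (Real.sin ((2 * n + 1) * ψ) * s.im + Real.cos ((2 * n + 1) * ψ) * s.re) := by
  have h1 : ((2 * n + 1 : ℕ) : ℝ) * Complex.arg z = (n + 1 / 2) * (Real.pi - 2 * ψ) := by
    rw [← h]; push_cast; ring
  have h2 : z ^ (2 * n + 1) = ((‖z‖ ^ (2 * n + 1) : ℝ) : ℂ) *
      ((Real.cos ((n + 1 / 2) * (Real.pi - 2 * ψ)) : ℝ) +
        (Real.sin ((n + 1 / 2) * (Real.pi - 2 * ψ)) : ℝ) * Complex.I) := by
    conv_lhs => rw [← Complex.norm_mul_cos_add_sin_mul_I z]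
    rw [mul_pow, Complex.cos_add_sin_mul_I_pow, ← h1]
    push_cast
    rfl
  have h3 : ∀ u w : ℝ, (((u : ℂ) + w * Complex.I) * s).im = u * s.im + w * s.re :=
    fun u w => by simp
  rw [h2, mul_assoc, Complex.im_ofReal_mul, h3, cos_add_half_mul, sin_add_half_mul]
  ring

lemma sidePhasor_re {a b : ℝ} (hb : 0 < b) :
    (sidePhasor a b).re = Real.sqrt b * Real.sqrt (1 + a + b) := by
  simp [sidePhasor, Real.sqrt_mul hb.le]

lemma sidePhasor_im (a b : ℝ) : (sidePhasor a b).im = Real.sqrt a := by simp [sidePhasor]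

lemma sidePhasor_ne_zero {a b : ℝ} (ha : 0 < a) : sidePhasor a b ≠ 0 := fun h => by
  have := sidePhasor_im a b
  rw [h, Complex.zero_im] at this
  exact (Real.sqrt_pos.2 ha).ne this

lemma tan_sq_of_phasor {a b R s c : ℝ} (ha : 0 < a) (hb : 0 < b) (hR : 0 < R)
    (h1 : R * s = Real.sqrt a * Real.sqrt (1 + a + b)) (h2 : R * c = Real.sqrt b) :
    R ^ 2 * s ^ 2 = a * (1 + a + b) ∧ R ^ 2 * c ^ 2 = b ∧
      b * s ^ 2 = a * (1 + a + b) * c ^ 2 := by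
  have h3 : R ^ 2 * s ^ 2 = a * (1 + a + b) := by
    rw [← mul_pow, h1, mul_pow, Real.sq_sqrt ha.le, Real.sq_sqrt (by linarith)]
  have h4 : R ^ 2 * c ^ 2 = b := by rw [← mul_pow, h2, Real.sq_sqrt hb.le]
  refine ⟨h3, h4, mul_left_cancel₀ (pow_pos hR 2).ne' ?_⟩
  linear_combination b * h3 - a * (1 + a + b) * h4

lemma mem_curveEven_iff_phasor {n : ℕ} (hn : 1 ≤ n) {a b : ℝ} (ha : 0 < a) (hb : 0 < b) :
    (a, b) ∈ curveEven n ↔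
      (thetaPhasor a b / (starRingEnd ℂ) (thetaPhasor a b)) ^ (2 * n + 1) =
          (starRingEnd ℂ) (sidePhasor a b) / sidePhasor a b ∧
        2 * Complex.arg (thetaPhasor a b) ∈ thetaInterval n := by
  obtain ⟨ψ, harg, hψ0, hψ, hR, hs, hc⟩ := exists_angle_thetaPhasor ha hb
  have hn' : (1 : ℝ) ≤ n := by exact_mod_cast hn
  have e1 : 2 * (n : ℝ) * ψ = (2 * n + 1) * ψ - ψ := by ring
  obtain ⟨h3, h4, h5⟩ := tan_sq_of_phasor ha hb hR hs hc
  rw [div_conj_pow_eq_iff (norm_pos_iff.1 hR) (sidePhasor_ne_zero ha), thetaPhasor_pow_im harg,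
    sidePhasor_re hb, sidePhasor_im, harg, mem_thetaInterval_iff,
    mem_curveEven_iff_of_angle hn ha hb hψ0 hψ h5]
  have hiff : Real.sin ψ * Real.cos (2 * n * ψ) = a * (Real.cos ψ * Real.sin (2 * n * ψ)) ↔
      ‖thetaPhasor a b‖ ^ (2 * n + 1) * (-1) ^ n * (Real.sin ((2 * n + 1) * ψ) * Real.sqrt a +
        Real.cos ((2 * n + 1) * ψ) * (Real.sqrt b * Real.sqrt (1 + a + b))) = 0 := by
    have hne : ‖thetaPhasor a b‖ ^ (2 * n + 1) * (-1) ^ n ≠ 0 :=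
      mul_ne_zero (pow_ne_zero _ hR.ne') (pow_ne_zero _ (by norm_num))
    have hkey : ‖thetaPhasor a b‖ ^ 2 * (a * (Real.cos ψ * Real.sin (2 * n * ψ)) -
        Real.sin ψ * Real.cos (2 * n * ψ)) = -((a + 1) * Real.sqrt a) *
          (Real.sin ((2 * n + 1) * ψ) * Real.sqrt a +
            Real.cos ((2 * n + 1) * ψ) * (Real.sqrt b * Real.sqrt (1 + a + b))) := by
      rw [e1, expand_sub_angle]
      linear_combination (a * h4 - h3) * Real.sin ((2 * n + 1) * ψ) +
        (a + 1) * Real.sin ((2 * n + 1) * ψ) * Real.mul_self_sqrt ha.le -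
        (a + 1) * Real.cos ((2 * n + 1) * ψ) * (‖thetaPhasor a b‖ * Real.cos ψ * hs +
          Real.sqrt a * Real.sqrt (1 + a + b) * hc)
    have ha' := Real.sqrt_pos.2 ha
    rw [mul_eq_zero, or_iff_right hne, eq_comm, ← sub_eq_zero,
      ← mul_right_inj' (pow_pos hR 2).ne', mul_zero, hkey, mul_eq_zero,
      or_iff_right (neg_ne_zero.2 (mul_pos (by linarith) ha').ne')]
  rw [← hiff]
  have hle : 2 * ψ ≤ 2 * n * ψ := mul_le_mul_of_nonneg_right (by linarith) hψ0.le
  constructor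
  · rintro ⟨h1, h2⟩
    refine ⟨h2, hψ0, ?_⟩
    have hs0 : 0 < Real.sin ψ := Real.sin_pos_of_pos_of_lt_pi hψ0 (by linarith)
    have hc0 : 0 < Real.cos ψ := Real.cos_pos_of_mem_Ioo ⟨by linarith, hψ⟩
    have hs2 : 0 < Real.sin (2 * n * ψ) := Real.sin_pos_of_pos_of_lt_pi (by linarith) h1
    have hlt : 2 * n * ψ < Real.pi / 2 := by
      by_contra! h6
      have := Real.cos_nonpos_of_pi_div_two_le_of_le h6 (by linarith)
      nlinarith [mul_pos ha (mul_pos hc0 hs2)]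
    linarith
  · rintro ⟨h1, -, h2⟩
    exact ⟨by linarith, h1⟩

lemma mem_curveOdd_iff_phasor {n : ℕ} (hn : 1 ≤ n) {a b : ℝ} (ha : 0 < a) (hb : 0 < b) :
    (a, b) ∈ curveOdd n ↔
      (thetaPhasor a b / (starRingEnd ℂ) (thetaPhasor a b)) ^ (2 * n + 1) =
          sidePhasor a b / (starRingEnd ℂ) (sidePhasor a b) ∧
        2 * Complex.arg (thetaPhasor a b) ∈ thetaInterval n := by
  obtain ⟨ψ, harg, hψ0, hψ, hR, hs, hc⟩ := exists_angle_thetaPhasor ha hb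
  have hn' : (1 : ℝ) ≤ n := by exact_mod_cast hn
  have e1 : (2 * (n : ℝ) + 2) * ψ = (2 * n + 1) * ψ + ψ := by ring
  obtain ⟨h3, h4, h5⟩ := tan_sq_of_phasor ha hb hR hs hc
  have hphasor := div_conj_pow_eq_iff (norm_pos_iff.1 hR)
    ((map_ne_zero (starRingEnd ℂ)).2 (sidePhasor_ne_zero (b := b) ha)) (2 * n + 1)
  rw [Complex.conj_conj] at hphasor
  rw [hphasor, thetaPhasor_pow_im harg, Complex.conj_re, Complex.conj_im,
    sidePhasor_re hb, sidePhasor_im, harg, mem_thetaInterval_iff,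
    mem_curveOdd_iff_of_angle ha hb hψ0 hψ h5]
  have hiff : Real.sin ψ * Real.cos ((2 * n + 2) * ψ) =
        -a * (Real.cos ψ * Real.sin ((2 * n + 2) * ψ)) ↔
      Real.sin ((2 * n + 1) * ψ) * -Real.sqrt a +
        Real.cos ((2 * n + 1) * ψ) * (Real.sqrt b * Real.sqrt (1 + a + b)) = 0 := by
    have hkey : ‖thetaPhasor a b‖ ^ 2 * (Real.sin ψ * Real.cos ((2 * n + 2) * ψ) -
        -a * (Real.cos ψ * Real.sin ((2 * n + 2) * ψ))) = ((a + 1) * Real.sqrt a) *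
          (Real.sin ((2 * n + 1) * ψ) * -Real.sqrt a +
            Real.cos ((2 * n + 1) * ψ) * (Real.sqrt b * Real.sqrt (1 + a + b))) := by
      have h6 := expand_add_angle ((2 * n + 1) * ψ) ψ a
      rw [← e1] at h6
      linear_combination ‖thetaPhasor a b‖ ^ 2 * h6 +
        (a * h4 - h3) * Real.sin ((2 * n + 1) * ψ) +
        (a + 1) * Real.sin ((2 * n + 1) * ψ) * Real.mul_self_sqrt ha.le +
        (a + 1) * Real.cos ((2 * n + 1) * ψ) * (‖thetaPhasor a b‖ * Real.cos ψ * hs +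
          Real.sqrt a * Real.sqrt (1 + a + b) * hc)
    have ha' := Real.sqrt_pos.2 ha
    rw [← sub_eq_zero,
      ← mul_right_inj' (pow_pos hR 2).ne', mul_zero, hkey, mul_eq_zero,
      or_iff_right (mul_pos (by linarith) ha').ne']
  have hne : ‖thetaPhasor a b‖ ^ (2 * n + 1) * (-1) ^ n ≠ 0 :=
    mul_ne_zero (pow_ne_zero _ hR.ne') (pow_ne_zero _ (by norm_num))
  rw [hiff, mul_eq_zero, or_iff_right hne]
  constructor
  · rintro ⟨h1, h2⟩
    exact ⟨h2, hψ0, by linarith⟩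
  · rintro ⟨h1, -, h2⟩
    refine ⟨?_, h1⟩
    have hS : 0 < Real.sin ((2 * n + 1) * ψ) := Real.sin_pos_of_pos_of_lt_pi (by positivity) h2
    have hle : 3 * ψ ≤ (2 * n + 1) * ψ := mul_le_mul_of_nonneg_right (by linarith) hψ0.le
    have hlt : (2 * n + 1) * ψ < Real.pi / 2 := by
      by_contra! h6
      have h7 := Real.cos_nonpos_of_pi_div_two_le_of_le h6 (by linarith)
      have h8 : 0 < Real.sqrt b * Real.sqrt (1 + a + b) := by positivity
      nlinarith [mul_pos hS (Real.sqrt_pos.2 ha)]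
    linarith

/-! ### The first four curves -/

lemma exists_angle_of_tan_sq {P : ℝ} (hP : 0 < P) :
    ∃ ψ, 0 < ψ ∧ ψ < Real.pi / 2 ∧ Real.sin ψ ^ 2 = P * Real.cos ψ ^ 2 := by
  refine ⟨Real.arctan (Real.sqrt P), Real.arctan_pos.2 (Real.sqrt_pos.2 hP),
    Real.arctan_lt_pi_div_two _, ?_⟩
  have h := Real.tan_mul_cos (Real.cos_arctan_pos (Real.sqrt P)).ne'
  rw [Real.tan_arctan] at h
  rw [← h, mul_pow, Real.sq_sqrt hP.le]

lemma cos_two_mul_of_tan_sq {P ψ : ℝ} (h : Real.sin ψ ^ 2 = P * Real.cos ψ ^ 2) :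
    Real.cos (2 * ψ) = (1 - P) * Real.cos ψ ^ 2 := by
  rw [Real.cos_two_mul']; linarith

lemma tan_mul_cot_two_iff {P ψ a : ℝ} (hs : 0 < Real.sin ψ) (hc : 0 < Real.cos ψ)
    (h : Real.sin ψ ^ 2 = P * Real.cos ψ ^ 2) :
    Real.sin ψ * Real.cos (2 * ψ) = a * (Real.cos ψ * Real.sin (2 * ψ)) ↔ 1 - P = 2 * a := by
  have h1 : Real.sin ψ * Real.cos ψ ^ 2 ≠ 0 := by positivity
  rw [cos_two_mul_of_tan_sq h, Real.sin_two_mul]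
  constructor
  · intro h2
    exact mul_left_cancel₀ h1 (by linear_combination h2)
  · intro h2
    linear_combination Real.sin ψ * Real.cos ψ ^ 2 * h2

lemma tan_mul_cot_four_iff {P ψ a : ℝ} (hs : 0 < Real.sin ψ) (hc : 0 < Real.cos ψ)
    (h : Real.sin ψ ^ 2 = P * Real.cos ψ ^ 2) :
    Real.sin ψ * Real.cos (4 * ψ) = a * (Real.cos ψ * Real.sin (4 * ψ)) ↔
      1 - 6 * P + P ^ 2 = 4 * a * (1 - P) := by
  have h1 : Real.sin ψ * Real.cos ψ ^ 4 ≠ 0 := by positivity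
  have h2 : Real.cos (4 * ψ) = (1 - 6 * P + P ^ 2) * Real.cos ψ ^ 4 := by
    rw [show 4 * ψ = 2 * (2 * ψ) by ring, Real.cos_two_mul', Real.sin_two_mul,
      cos_two_mul_of_tan_sq h, mul_pow, mul_pow, mul_pow, h]
    ring
  have h3 : Real.sin (4 * ψ) = 4 * (1 - P) * Real.sin ψ * Real.cos ψ ^ 3 := by
    rw [show 4 * ψ = 2 * (2 * ψ) by ring, Real.sin_two_mul, Real.sin_two_mul,
      cos_two_mul_of_tan_sq h]
    ring
  rw [h2, h3]
  constructor
  · intro h4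
    exact mul_left_cancel₀ h1 (by linear_combination h4)
  · intro h4
    linear_combination Real.sin ψ * Real.cos ψ ^ 4 * h4

lemma four_mul_lt_pi_iff {P ψ : ℝ} (hψ0 : 0 < ψ) (hψ : ψ < Real.pi / 2)
    (h : Real.sin ψ ^ 2 = P * Real.cos ψ ^ 2) : 4 * ψ < Real.pi ↔ P < 1 := by
  have hc : 0 < Real.cos ψ ^ 2 := pow_pos (Real.cos_pos_of_mem_Ioo ⟨by linarith, hψ⟩) 2
  have h1 := cos_two_mul_of_tan_sq h
  constructor
  · intro h2
    have h3 : 0 < (1 - P) * Real.cos ψ ^ 2 :=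
      h1 ▸ Real.cos_pos_of_mem_Ioo ⟨by linarith, by linarith⟩
    linarith [pos_of_mul_pos_left h3 hc.le]
  · intro h2
    by_contra! h3
    have h4 := Real.cos_nonpos_of_pi_div_two_le_of_le (x := 2 * ψ) (by linarith) (by linarith)
    have h5 := mul_pos (sub_pos.2 h2) hc
    linarith

/-- The first four curves: `tan ψ cot (2ψ)` and `tan ψ cot (4ψ)` are rational functions of
`tan² ψ = a (1 + a + b) / b`. -/
lemma first_curves {a b : ℝ} (ha : 0 < a) (hb : 0 < b) :
    ((a, b) ∈ curveOdd 0 ↔ b - a = 0) ∧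
    ((a, b) ∈ curveEven 1 ↔ 3 * a * b - b + a ^ 2 + a = 0) ∧
    ((a, b) ∈ curveOdd 1 ↔
      3 * a * b ^ 2 - b ^ 2 + 2 * b * a ^ 2 + 6 * a * b - a ^ 3 - a ^ 2 = 0 ∧ a < b) ∧
    ((a, b) ∈ curveEven 2 ↔
      5 * a ^ 2 * b ^ 2 - 10 * a * b ^ 2 + b ^ 2 + 6 * b * a ^ 3 - 6 * a * b
        + a ^ 4 + 2 * a ^ 3 + a ^ 2 = 0 ∧ a < b ∧ a < 1) := by
  obtain ⟨P, hP⟩ : ∃ P, P * b = a * (1 + a + b) :=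
    ⟨a * (1 + a + b) / b, div_mul_cancel₀ _ hb.ne'⟩
  have hP0 : 0 < P := pos_of_mul_pos_left (hP ▸ by positivity) hb.le
  obtain ⟨ψ, hψ0, hψ, h⟩ := exists_angle_of_tan_sq hP0
  have hs : 0 < Real.sin ψ := Real.sin_pos_of_pos_of_lt_pi hψ0 (by linarith)
  have hc : 0 < Real.cos ψ := Real.cos_pos_of_mem_Ioo ⟨by linarith, hψ⟩
  have h' : b * Real.sin ψ ^ 2 = a * (1 + a + b) * Real.cos ψ ^ 2 := by rw [h, ← hP]; ring
  -- `a < b` is a bound on `tan² ψ`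
  have hab : a < b ↔ P < 1 + 2 * a := by
    have e : b * (1 + 2 * a - P) = (1 + a) * (b - a) := by linear_combination -hP
    have ha1 : 0 < 1 + a := by linarith
    rw [← sub_pos, ← mul_pos_iff_of_pos_left ha1, ← e, mul_pos_iff_of_pos_left hb, sub_pos]
  rw [mem_curveOdd_iff_of_angle ha hb hψ0 hψ h', mem_curveOdd_iff_of_angle ha hb hψ0 hψ h',
    mem_curveEven_iff_of_angle le_rfl ha hb hψ0 hψ h',
    mem_curveEven_iff_of_angle one_le_two ha hb hψ0 hψ h']
  have e0 : 2 * ((0 : ℕ) : ℝ) + 2 = 2 := by norm_num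
  have e1 : 2 * ((1 : ℕ) : ℝ) = 2 := by norm_num
  have e2 : (2 : ℝ) + 2 = 4 := by norm_num
  have e3 : 2 * ((2 : ℕ) : ℝ) = 4 := by norm_num
  rw [e0, e1, e2, e3, tan_mul_cot_two_iff hs hc h, tan_mul_cot_two_iff hs hc h,
    tan_mul_cot_four_iff hs hc h, tan_mul_cot_four_iff hs hc h, four_mul_lt_pi_iff hψ0 hψ h]
  have h2 : 2 * ψ < Real.pi := by linarith
  simp only [h2, true_and]
  have hb2 : b ^ 2 ≠ 0 := by positivity
  refine ⟨?_, ?_, ?_, ?_⟩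
  · rw [← mul_right_inj' hb.ne']
    constructor
    · intro h3
      refine mul_left_cancel₀ (by linarith : 1 + a ≠ 0) ?_
      linear_combination h3 + hP
    · intro h3
      linear_combination (1 + a) * h3 - hP
  · rw [← mul_right_inj' hb.ne']
    constructor
    · intro h3
      linear_combination -h3 - hP
    · intro h3
      linear_combination -h3 - hP
  · have key : b ^ 2 * (1 - 6 * P + P ^ 2 - 4 * -a * (1 - P)) = -(1 + a) *
        (3 * a * b ^ 2 - b ^ 2 + 2 * b * a ^ 2 + 6 * a * b - a ^ 3 - a ^ 2) := by
      linear_combination (-6 * b - 4 * a * b + P * b + a * (1 + a + b)) * hP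
    constructor
    · rintro ⟨h3, h4⟩
      refine ⟨?_, hab.2 (by linarith)⟩
      rw [h4, sub_self, mul_zero, eq_comm, mul_eq_zero] at key
      exact key.resolve_left (by linarith)
    · rintro ⟨h3, h4⟩
      rw [h3, mul_zero, mul_eq_zero, or_iff_right hb2] at key
      refine ⟨?_, by linarith⟩
      have h5 := hab.1 h4
      by_contra! h6
      nlinarith
  · have key : b ^ 2 * (4 * a * (1 - P) - (1 - 6 * P + P ^ 2)) =
        -(5 * a ^ 2 * b ^ 2 - 10 * a * b ^ 2 + b ^ 2 + 6 * b * a ^ 3 - 6 * a * b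
          + a ^ 4 + 2 * a ^ 3 + a ^ 2) := by
      linear_combination (6 * b - 4 * a * b - P * b - a * (1 + a + b)) * hP
    constructor
    · rintro ⟨h3, h4⟩
      refine ⟨?_, hab.2 (by linarith), ?_⟩
      · rw [h4, sub_self, mul_zero] at key
        linarith
      · by_contra! h5
        nlinarith
    · rintro ⟨h3, h4, h5⟩
      rw [h3, neg_zero, mul_eq_zero, or_iff_right hb2] at key
      refine ⟨?_, by linarith⟩
      have h6 := hab.1 h4
      -- otherwise `a < 1` forces `P > 3`, against `P < 1 + 2 a`
      by_contra! h7
      nlinarith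

/-! ### Angles and capture processes -/

lemma sin_pos_of_mul_lt_pi {n : ℕ} {ψ : ℝ} (h0 : 0 < ψ) (h : (2 * n + 1) * ψ < Real.pi) :
    0 < Real.sin ψ := by
  have : (0 : ℝ) ≤ 2 * n * ψ := by positivity
  exact Real.sin_pos_of_pos_of_lt_pi h0 (by linarith)

lemma isCaptureAngle_iff {n : ℕ} {a b ψ : ℝ} (ha : 0 < a) (hb : 0 < b) :
    IsCaptureAngle n a b ψ ↔ Real.pi - 2 * ψ ∈ thetaInterval n ∧
      ThetaEquation n a b (Real.pi - 2 * ψ) ∧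
      Real.sin ((Real.pi - 2 * ψ) / 2) ^ 2 ≤ b / ((a + b) * (a + 1)) := by
  rw [mem_thetaInterval_iff, show (Real.pi - 2 * ψ) / 2 = Real.pi / 2 - ψ by ring,
    Real.sin_pi_div_two_sub, le_div_iff₀ (by positivity)]
  constructor
  · rintro ⟨h0, h1, h2, h3⟩
    exact ⟨⟨h0, h1⟩, (thetaEquation_iff ha hb (sin_pos_of_mul_lt_pi h0 h1)).2 h2, h3⟩
  · rintro ⟨⟨h0, h1⟩, h2, h3⟩
    exact ⟨h0, h1, (thetaEquation_iff ha hb (sin_pos_of_mul_lt_pi h0 h1)).1 h2, h3⟩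

lemma classicallyAllowed_iff {n : ℕ} (hn : 1 ≤ n) {a b : ℝ} (ha : 0 < a) (hb : 0 < b) :
    ClassicallyAllowed a b (2 * n + 1) collisions232 ↔ ∃ ψ, IsCaptureAngle n a b ψ := by
  constructor
  · rintro ⟨x, t, r, v, h⟩
    obtain ⟨-, ψ, hψ, -⟩ := h.exists_isCaptureAngle hn ha hb
    exact ⟨ψ, hψ⟩
  · rintro ⟨ψ, hψ⟩
    exact hψ.classicallyAllowed hn ha hb

lemma thetaEquation_subsingleton {n : ℕ} (hn : 1 ≤ n) {a b : ℝ} (ha : 0 < a) (hb : 0 < b) :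
    {θ | θ ∈ thetaInterval n ∧ ThetaEquation n a b θ}.Subsingleton := by
  have key : ∀ θ θ' : ℝ, θ ∈ thetaInterval n ∧ ThetaEquation n a b θ →
      θ' ∈ thetaInterval n ∧ ThetaEquation n a b θ' → ¬ θ < θ' := by
    rintro θ θ' ⟨h1, h2⟩ ⟨h3, h4⟩ hlt
    obtain ⟨ψ, rfl⟩ : ∃ ψ, θ = Real.pi - 2 * ψ := ⟨(Real.pi - θ) / 2, by ring⟩
    obtain ⟨ψ', rfl⟩ : ∃ ψ, θ' = Real.pi - 2 * ψ := ⟨(Real.pi - θ') / 2, by ring⟩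
    rw [mem_thetaInterval_iff] at h1 h3
    rw [thetaEquation_iff ha hb (sin_pos_of_mul_lt_pi h1.1 h1.2)] at h2
    rw [thetaEquation_iff ha hb (sin_pos_of_mul_lt_pi h3.1 h3.2)] at h4
    exact angle_unique hn ha hb h3.1 (by linarith) h1.2 h4 h2
  intro θ h θ' h'
  exact le_antisymm (not_lt.1 (key θ' θ h' h)) (not_lt.1 (key θ θ' h h'))

lemma sub_one_sq_div_of_norm_eq_one {y : ℂ} (hy : ‖y‖ = 1) (g : ℂ) :
    g * (y - 1) ^ 2 / (2 * y) = -(g * (2 - 2 * y.re)) / 2 := by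
  have h0 : y ≠ 0 := by rw [← norm_ne_zero_iff, hy]; exact one_ne_zero
  have h1 : (starRingEnd ℂ) y * y = 1 := by
    rw [mul_comm, Complex.mul_conj, Complex.normSq_eq_norm_sq, hy]
    simp
  have h2 := Complex.add_conj y
  push_cast at h2
  field_simp
  linear_combination g * y * h2 - g * h1

theorem mainTheorem2 :
    (∀ n : ℕ, 1 ≤ n → ∀ a b : ℝ, 0 < a → 0 < b →
      -- the allowed region
      (ClassicallyAllowed a b (2 * n + 1) collisions232 ↔
        LiesBetween (curveEven n) (curveOdd n) a b) ∧
      -- the angle `θ`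
      (ClassicallyAllowed a b (2 * n + 1) collisions232 ↔
        ∃ θ ∈ thetaInterval n, ThetaEquation n a b θ ∧
          Real.sin (θ / 2) ^ 2 ≤ b / ((a + b) * (a + 1))) ∧
      {θ | θ ∈ thetaInterval n ∧ ThetaEquation n a b θ}.Subsingleton ∧
      (∀ (x : ℕ → ℂ) (t : ℕ → ℝ) (r v : ℕ → Fin 3 → ℂ),
        IsCaptureProcess a b (2 * n + 1) collisions232 x t r v →
          (∀ k, 1 ≤ k → k < 2 * n + 1 → x k = x 1) ∧
          ∃ θ ∈ thetaInterval n,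
            (Real.cos θ : ℂ) = 1 + b * (x 1 - 1) ^ 2 / (2 * x 1 * (a + 1) * (a + b)) ∧
            ThetaEquation n a b θ) ∧
      -- the implicit equations of the boundary curves
      ((a, b) ∈ curveEven n ↔
        (thetaPhasor a b / (starRingEnd ℂ) (thetaPhasor a b)) ^ (2 * n + 1) =
            (starRingEnd ℂ) (sidePhasor a b) / sidePhasor a b ∧
          2 * Complex.arg (thetaPhasor a b) ∈ thetaInterval n) ∧
      ((a, b) ∈ curveOdd n ↔
        (thetaPhasor a b / (starRingEnd ℂ) (thetaPhasor a b)) ^ (2 * n + 1) =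
            sidePhasor a b / (starRingEnd ℂ) (sidePhasor a b) ∧
          2 * Complex.arg (thetaPhasor a b) ∈ thetaInterval n)) ∧
    -- the first four boundary curves
    (∀ a b : ℝ, 0 < a → 0 < b →
      ((a, b) ∈ curveOdd 0 ↔ b - a = 0) ∧
      ((a, b) ∈ curveEven 1 ↔ 3 * a * b - b + a ^ 2 + a = 0) ∧
      ((a, b) ∈ curveOdd 1 ↔
        3 * a * b ^ 2 - b ^ 2 + 2 * b * a ^ 2 + 6 * a * b - a ^ 3 - a ^ 2 = 0 ∧ a < b) ∧
      ((a, b) ∈ curveEven 2 ↔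
        5 * a ^ 2 * b ^ 2 - 10 * a * b ^ 2 + b ^ 2 + 6 * b * a ^ 3 - 6 * a * b
          + a ^ 4 + 2 * a ^ 3 + a ^ 2 = 0 ∧ a < b ∧ a < 1)) := by

  refine ⟨fun n hn a b ha hb => ⟨?_, ?_, ?_, ?_, ?_, ?_⟩, fun a b ha hb => first_curves ha hb⟩
  · rw [classicallyAllowed_iff hn ha hb, exists_isCaptureAngle_iff_liesBetween hn ha hb]
  · rw [classicallyAllowed_iff hn ha hb]
    constructor
    · rintro ⟨ψ, hψ⟩
      exact ⟨_, (isCaptureAngle_iff ha hb).1 hψ⟩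
    · rintro ⟨θ, h⟩
      obtain ⟨ψ, rfl⟩ : ∃ ψ, θ = Real.pi - 2 * ψ := ⟨(Real.pi - θ) / 2, by ring⟩
      exact ⟨ψ, (isCaptureAngle_iff ha hb).2 h⟩
  · exact thetaEquation_subsingleton hn ha hb
  · intro x t r v h
    obtain ⟨hx, ψ, hψ, hκ⟩ := h.exists_isCaptureAngle hn ha hb
    obtain ⟨h1, h2, -⟩ := (isCaptureAngle_iff ha hb).1 hψ
    refine ⟨hx, _, h1, ?_, h2⟩
    have h3 := sub_one_sq_div_of_norm_eq_one (h.phasor 1 (by omega))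
      ((b / ((a + b) * (a + 1)) : ℝ) : ℂ)
    have h4 : ((b / ((a + b) * (a + 1)) : ℝ) : ℂ) * (2 - 2 * (x 1).re) =
        4 * (Real.cos ψ : ℂ) ^ 2 := by exact_mod_cast hκ.symm
    have h5 : (b : ℂ) * (x 1 - 1) ^ 2 / (2 * x 1 * (a + 1) * (a + b)) =
        ((b / ((a + b) * (a + 1)) : ℝ) : ℂ) * (x 1 - 1) ^ 2 / (2 * x 1) := by
      push_cast
      rw [div_mul_eq_mul_div, div_div]
      congr 1
      ring
    rw [h5, h3, h4, Real.cos_pi_sub, Real.cos_two_mul]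
    push_cast
    ring
  · exact mem_curveEven_iff_phasor hn ha hb
  · exact mem_curveOdd_iff_phasor hn ha hb
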